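/- Let $\Lambda$ be a commutative local uniserial ring of length $n$ (its ideals form a chain and it has length $n$ as a module over itself), let $p$ be a generator of its maximal ideal $\mathfrak m$, and let $k=\Lambda/\mathfrak m$. Let $\mathcal S_2(\Lambda)$ be the category whose objects are the pairs $(B;A)$ consisting of a finitely generated $\Lambda$-module $B$ and a submodule $A\subset B$ with $p^2A=0$, and whose morphisms $(B;A)\to(D;C)$ are the $\Lambda$-linear maps $f:B\to D$ with $f(A)\subset C$. Let $\mathcal P_n$ be the poset consisting of a chain $n-1<\dots<2<1$ and two further points $1',1''$, incomparable to each other and to the points of the chain. Let $\operatorname{rep}_k\mathcal P_n$ be the category of finite dimensional representations of $\mathcal P_n$: an object is a finite dimensional $k$-vector space $V^0$ with subspaces $V^i\subset V^0$ ($i\in\mathcal P_n$) such that $V^i\subset V^j$ whenever $i<j$; a morphism $V\to W$ is a $k$-linear map $h:V^0\to W^0$ with $h(V^i)\subset W^i$ for all $i$. Write $V'=V^{1'}$, $V''=V^{1''}$, and let $\operatorname{rep}'_k\mathcal P_n$ be the full subcategory of the representations with $V^{n-1}\subset V'$ and $V'+V''=V^0$ (if $n=1$, then $V^{n-1}=V^0$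 is the total space). For $(B;A)\in\mathcal S_2(\Lambda)$ put $A^-=\operatorname{rad}A=\mathfrak mA$, $A^+=A+\operatorname{soc}B$ and, for a submodule $C\subset B$, $\widetilde C=((C\cap A^+)+A^-)/A^-\subset A^+/A^-$. Let $F:\mathcal S_2(\Lambda)\to\operatorname{rep}_k\mathcal P_n$ be the additive functor that sends $(B;A)$ to the representation with $V^0=A^+/A^-$, $V^\ell=\widetilde{\operatorname{rad}^\ell B}$ for $1\le\ell\le n-1$, $V'=\widetilde{\operatorname{soc}B}$, $V''=\widetilde A$, and sends a morphism $f:(B;A)\to(D;C)$ to the map $A^+/A^-\to C^+/C^-$ induced by $f$. Let $\mathcal N$ be the categorical ideal of $\mathcal S_2(\Lambda)$ consisting of the morphisms $f:(B;A)\to(D;C)$ with $f(A+\operatorname{soc}B)\subset\operatorname{rad}C$. Then the kernel of $F$ is $\mathcal N$: for every morphism $f$ of $\mathcal S_2(\Lambda)$, $F(f)=0$ if and only if $f\in\mathcal N$. Moreover, $F$ takes its values in $\operatorname{rep}'_k\mathcal P_n$ and induces an additive equivalence of categories $$\bar F:\ \mathcal S_2(\Lambda)/\mathcal N\ \longrightarrow\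 \operatorname{rep}'_k\mathcal P_n .$$ -/

import Mathlib

open CategoryTheory IsLocalRing

universe u

noncomputable section

/-- A commutative ring is *uniserial of length `n`* if its ideals form a chain and it has
length `n` as a module over itself. -/
class IsUniserialOfLength (Λ : Type u) [CommRing Λ] (n : ℕ) : Prop where
  ideal_total : ∀ I J : Ideal Λ, I ≤ J ∨ J ≤ I
  length_eq : Module.length Λ Λ = n

theorem IsUniserialOfLength.isNoetherianRing (Λ : Type u) [CommRing Λ] (n : ℕ)
    [h : IsUniserialOfLength Λ n] : IsNoetherianRing Λ := by
  have h1 : Module.length Λ Λ ≠ ⊤ := by rw [h.length_eq]; exact ENat.natCast_ne_top n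
  exact (isFiniteLength_iff_isNoetherian_isArtinian.mp (Module.length_ne_top_iff.mp h1)).1

/-! ### Radical and socle -/

section RadSoc

variable {Λ : Type u} [CommRing Λ]

/-- The socle of a module: the sum of its simple submodules. -/
def soc (Λ : Type u) [CommRing Λ] (M : Type u) [AddCommGroup M] [Module Λ M] : Submodule Λ M :=
  sSup {S : Submodule Λ M | IsSimpleModule Λ S}

variable {M N : Type u} [AddCommGroup M] [Module Λ M] [AddCommGroup N] [Module Λ N]

theorem soc_le_comap (f : M →ₗ[Λ] N) : soc Λ M ≤ (soc Λ N).comap f := by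
  refine sSup_le fun S hS => ?_
  have hS : IsSimpleModule Λ S := hS
  rw [← Submodule.map_le_iff_le_comap]
  have hr : S.map f = LinearMap.range (f.domRestrict S) := by
    rw [LinearMap.domRestrict, LinearMap.range_comp, Submodule.range_subtype]
  rcases LinearMap.injective_or_eq_zero (f.domRestrict S) with h | h
  · refine le_sSup ?_
    show IsSimpleModule Λ (S.map f)
    rw [hr]
    exact IsSimpleModule.congr (LinearEquiv.ofInjective _ h).symm
  · rw [hr, h, LinearMap.range_zero]
    exact bot_le

variable [IsLocalRing Λ]

/-- The power `rad^ℓ U` of the radical of a submodule `U`, where `rad U = 𝔪 U`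
for the maximal ideal `𝔪` of the local ring `Λ`. -/
def radPow (ℓ : ℕ) (U : Submodule Λ M) : Submodule Λ M :=
  maximalIdeal Λ ^ ℓ • U

/-- The radical `rad U = 𝔪 U` of a submodule. -/
def rad (U : Submodule Λ M) : Submodule Λ M :=
  maximalIdeal Λ • U

theorem radPow_le_comap (ℓ : ℕ) (f : M →ₗ[Λ] N) {U : Submodule Λ M} {W : Submodule Λ N}
    (h : U ≤ W.comap f) : radPow ℓ U ≤ (radPow ℓ W).comap f := by
  rw [← Submodule.map_le_iff_le_comap] at h ⊢
  rw [radPow, Submodule.map_smul'']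
  exact Submodule.smul_mono le_rfl h

theorem rad_le_comap (f : M →ₗ[Λ] N) {U : Submodule Λ M} {W : Submodule Λ N}
    (h : U ≤ W.comap f) : rad U ≤ (rad W).comap f := by
  rw [← Submodule.map_le_iff_le_comap] at h ⊢
  rw [rad, Submodule.map_smul'']
  exact Submodule.smul_mono le_rfl h

theorem rad_le (U : Submodule Λ M) : rad U ≤ U := Submodule.smul_le_right

/-- Over a local ring, `𝔪 M` is the intersection of the maximal submodules of `M`. -/
theorem rad_top_eq_jacobson : rad (⊤ : Submodule Λ M) = Module.jacobson Λ M := by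
  refine le_antisymm ?_ (Module.jacobson_le_of_eq_bot ?_)
  · rw [rad, ← IsLocalRing.ringJacobson_eq_maximalIdeal]
    exact Ring.jacobson_smul_top_le Λ M
  · have ht := Module.isTorsionBySet_quotient_ideal_smul M (maximalIdeal Λ)
    let := ht.module
    let := Ideal.Quotient.field (maximalIdeal Λ)
    have hs : IsSemisimpleModule (Λ ⧸ maximalIdeal Λ) (M ⧸ maximalIdeal Λ • (⊤ : Submodule Λ M)) :=
      inferInstance
    have : IsSemisimpleModule Λ (M ⧸ rad (⊤ : Submodule Λ M)) := ht.isSemisimpleModule_iff.mp hs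
    exact IsSemisimpleModule.jacobson_eq_bot Λ _

theorem smul_eq_zero_of_mem_soc {r : Λ} (hr : r ∈ maximalIdeal Λ) {x : M} (hx : x ∈ soc Λ M) :
    r • x = 0 := by
  suffices h : soc Λ M ≤ LinearMap.ker (LinearMap.lsmul Λ M r) from h hx
  refine sSup_le fun S hS x hxS => ?_
  have hS : IsSimpleModule Λ S := hS
  have h0 : maximalIdeal Λ ≤ Module.annihilator Λ S := by
    have := IsSimpleModule.annihilator_isMaximal (R := Λ) (M := S)
    exact (IsLocalRing.eq_maximalIdeal this).ge
  have := Module.mem_annihilator.mp (h0 hr) ⟨x, hxS⟩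
  simpa using congrArg Subtype.val this

/-- Over a local ring, the socle consists of the elements annihilated by `𝔪`. -/
theorem mem_soc_iff {x : M} : x ∈ soc Λ M ↔ ∀ r ∈ maximalIdeal Λ, r • x = 0 := by
  refine ⟨fun hx r hr => smul_eq_zero_of_mem_soc hr hx, fun hx => ?_⟩
  by_cases h0 : x = 0
  · rw [h0]
    exact Submodule.zero_mem _
  suffices h : IsSimpleModule Λ (Submodule.span Λ {x}) from
    le_sSup (a := Submodule.span Λ {x}) h (Submodule.mem_span_singleton_self x)
  have hk : LinearMap.ker (LinearMap.toSpanSingleton Λ M x) = maximalIdeal Λ := by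
    refine le_antisymm (IsLocalRing.le_maximalIdeal fun h => h0 ?_) fun r hr => hx r hr
    have h1 : (1 : Λ) ∈ LinearMap.ker (LinearMap.toSpanSingleton Λ M x) := h ▸ Submodule.mem_top
    simpa using h1
  have hq : IsSimpleModule Λ (Λ ⧸ LinearMap.ker (LinearMap.toSpanSingleton Λ M x)) := by
    rw [hk, isSimpleModule_iff_isCoatom]
    exact (IsLocalRing.maximalIdeal.isMaximal Λ).out
  rw [← LinearMap.range_toSpanSingleton]
  exact IsSimpleModule.congr (LinearMap.quotKerEquivRange _).symm

end RadSoc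

/-! ### The categories `S(Λ)` and `S_m(Λ)` -/

/-- A pair `(B; A)`: a finitely generated `Λ`-module `B` with a submodule `A`. -/
structure SubPair (Λ : Type u) [CommRing Λ] : Type (u + 1) where
  B : Type u
  [addCommGroup : AddCommGroup B]
  [module : Module Λ B]
  [finite : Module.Finite Λ B]
  A : Submodule Λ B

namespace SubPair

attribute [instance] SubPair.addCommGroup SubPair.module SubPair.finite

variable {Λ : Type u} [CommRing Λ]

/-- A morphism `(B; A) → (D; C)` is a linear map `f : B → D` with `f(A) ⊆ C`. -/
@[ext]
structure Hom (X Y : SubPair Λ) : Type u where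
  lin : X.B →ₗ[Λ] Y.B
  le_comap : X.A ≤ Y.A.comap lin

instance : Category (SubPair Λ) where
  Hom X Y := Hom X Y
  id _ := ⟨LinearMap.id, fun _ h => h⟩
  comp f g := ⟨g.lin ∘ₗ f.lin, fun _ h => g.le_comap (f.le_comap h)⟩

/-- The linear map underlying a morphism of pairs. -/
abbrev linMap {X Y : SubPair Λ} (f : X ⟶ Y) : X.B →ₗ[Λ] Y.B := Hom.lin f

@[ext]
theorem hom_ext {X Y : SubPair Λ} {f g : X ⟶ Y} (h : linMap f = linMap g) : f = g :=
  Hom.ext h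

theorem map_mem {X Y : SubPair Λ} (f : X ⟶ Y) {a : X.B} (ha : a ∈ X.A) : linMap f a ∈ Y.A :=
  Hom.le_comap f ha

/-- The maps `B → D` sending `A` into `C`, as an additive group. -/
def homSubgroup (X Y : SubPair Λ) : AddSubgroup (X.B →ₗ[Λ] Y.B) where
  carrier := {f | X.A ≤ Y.A.comap f}
  add_mem' hf hg _ h := Y.A.add_mem (hf h) (hg h)
  zero_mem' _ _ := Y.A.zero_mem
  neg_mem' hf _ h := Y.A.neg_mem (hf h)

/-- Morphisms of pairs as elements of `homSubgroup`. -/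
def homEquiv (X Y : SubPair Λ) : (X ⟶ Y) ≃ homSubgroup X Y where
  toFun f := ⟨Hom.lin f, Hom.le_comap f⟩
  invFun f := Hom.mk f.1 f.2

instance (X Y : SubPair Λ) : AddCommGroup (X ⟶ Y) := (homEquiv X Y).addCommGroup

@[simp] theorem linMap_id (X : SubPair Λ) : linMap (𝟙 X) = LinearMap.id := rfl
@[simp] theorem linMap_comp {X Y Z : SubPair Λ} (f : X ⟶ Y) (g : Y ⟶ Z) :
    linMap (f ≫ g) = linMap g ∘ₗ linMap f := rfl
@[simp] theorem linMap_add {X Y : SubPair Λ} (f g : X ⟶ Y) :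
    linMap (f + g) = linMap f + linMap g := rfl
@[simp] theorem linMap_zero {X Y : SubPair Λ} : linMap (0 : X ⟶ Y) = 0 := rfl
@[simp] theorem linMap_neg {X Y : SubPair Λ} (f : X ⟶ Y) : linMap (-f) = -linMap f := rfl
@[simp] theorem linMap_sub {X Y : SubPair Λ} (f g : X ⟶ Y) :
    linMap (f - g) = linMap f - linMap g := rfl

instance : Preadditive (SubPair Λ) where
  add_comp _ _ _ f g h := by ext; simp
  comp_add _ _ _ f g h := by ext; simp

/-- The pairs `(B; A)` with `p ^ m A = 0`. -/
def bounded (p : Λ) (m : ℕ) : ObjectProperty (SubPair Λ) :=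
  fun X => ∀ a ∈ X.A, p ^ m • a = 0

section LocalRing

variable [IsLocalRing Λ]

/-- `A⁻ = rad A`. -/
def Aminus (X : SubPair Λ) : Submodule Λ X.B := rad X.A

/-- `A⁺ = A + soc B`. -/
def Aplus (X : SubPair Λ) : Submodule Λ X.B := X.A ⊔ soc Λ X.B

theorem Aminus_le_comap {X Y : SubPair Λ} (f : X ⟶ Y) :
    X.Aminus ≤ Y.Aminus.comap (linMap f) :=
  rad_le_comap _ (Hom.le_comap f)

theorem Aplus_le_comap {X Y : SubPair Λ} (f : X ⟶ Y) : X.Aplus ≤ Y.Aplus.comap (linMap f) :=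
  sup_le (fun _ h => Submodule.mem_sup_left (map_mem f h))
    ((soc_le_comap (linMap f)).trans (Submodule.comap_mono le_sup_right))

theorem Aminus_le_Aplus (X : SubPair Λ) : X.Aminus ≤ X.Aplus :=
  (rad_le X.A).trans le_sup_left

theorem smul_mem_Aminus (X : SubPair Λ) {r : Λ} (hr : r ∈ maximalIdeal Λ) {x : X.B}
    (hx : x ∈ X.Aplus) : r • x ∈ X.Aminus := by
  obtain ⟨a, ha, s, hs, rfl⟩ := Submodule.mem_sup.mp hx
  rw [smul_add, smul_eq_zero_of_mem_soc hr hs, add_zero]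
  exact Submodule.smul_mem_smul hr ha

/-- The total space `A⁺ / A⁻`. -/
def TotalSpace (X : SubPair Λ) : Type u := X.Aplus ⧸ X.Aminus.submoduleOf X.Aplus

instance (X : SubPair Λ) : AddCommGroup X.TotalSpace :=
  inferInstanceAs (AddCommGroup (X.Aplus ⧸ X.Aminus.submoduleOf X.Aplus))

instance (X : SubPair Λ) : Module Λ X.TotalSpace :=
  inferInstanceAs (Module Λ (X.Aplus ⧸ X.Aminus.submoduleOf X.Aplus))

/-- The projection `A⁺ → A⁺ / A⁻`. -/
def proj (X : SubPair Λ) : X.Aplus →ₗ[Λ] X.TotalSpace :=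
  (X.Aminus.submoduleOf X.Aplus).mkQ

theorem proj_surjective (X : SubPair Λ) : Function.Surjective X.proj :=
  Submodule.mkQ_surjective _

theorem proj_eq_zero_iff (X : SubPair Λ) (x : X.Aplus) :
    X.proj x = 0 ↔ (x : X.B) ∈ X.Aminus :=
  Submodule.Quotient.mk_eq_zero _

theorem isTorsionBySet_totalSpace (X : SubPair Λ) :
    Module.IsTorsionBySet Λ X.TotalSpace (maximalIdeal Λ : Set Λ) := by
  rintro x ⟨r, hr⟩
  obtain ⟨y, rfl⟩ := X.proj_surjective x
  show r • X.proj y = 0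
  rw [← map_smul, proj_eq_zero_iff]
  exact X.smul_mem_Aminus hr y.2

/-- `A⁺ / A⁻` is annihilated by `𝔪`, so it is a vector space over `k = Λ / 𝔪`. -/
instance (X : SubPair Λ) : Module (ResidueField Λ) X.TotalSpace :=
  (X.isTorsionBySet_totalSpace.module : Module (Λ ⧸ maximalIdeal Λ) X.TotalSpace)

instance (X : SubPair Λ) : IsScalarTower Λ (ResidueField Λ) X.TotalSpace :=
  ⟨fun r c x => by
    obtain ⟨s, rfl⟩ := Ideal.Quotient.mk_surjective c
    exact mul_smul r s x⟩

/-- The subspace `C~ = ((C ∩ A⁺) + A⁻) / A⁻` of `A⁺ / A⁻`, for a submodule `C` of `B`. -/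
def tilde (X : SubPair Λ) (C : Submodule Λ X.B) : Submodule (ResidueField Λ) X.TotalSpace where
  __ := ((C ⊓ X.Aplus ⊔ X.Aminus).submoduleOf X.Aplus).map X.proj
  smul_mem' c x hx := by
    obtain ⟨r, rfl⟩ := IsLocalRing.residue_surjective c
    have h : residue Λ r • x = r • x := by
      rw [← IsLocalRing.ResidueField.algebraMap_eq, algebraMap_smul]
    rw [h]
    exact Submodule.smul_mem _ r hx

/-- For a morphism `f : (B; A) → (D; C)`, the `Λ`-linear map `A⁺ / A⁻ → C⁺ / C⁻` induced by `f`. -/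
def totalMapAux {X Y : SubPair Λ} (f : X ⟶ Y) : X.TotalSpace →ₗ[Λ] Y.TotalSpace :=
  Submodule.mapQ (X.Aminus.submoduleOf X.Aplus) (Y.Aminus.submoduleOf Y.Aplus)
    ((linMap f).restrict (Aplus_le_comap f)) (fun _ h => Aminus_le_comap f h)

/-- The `k`-linear map `A⁺ / A⁻ → C⁺ / C⁻` induced by a morphism `f : (B; A) → (D; C)`. -/
def totalMap {X Y : SubPair Λ} (f : X ⟶ Y) :
    X.TotalSpace →ₗ[ResidueField Λ] Y.TotalSpace :=
  (totalMapAux f).extendScalarsOfSurjective IsLocalRing.residue_surjective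

@[simp] theorem totalMap_proj {X Y : SubPair Λ} (f : X ⟶ Y) (x : X.Aplus) :
    totalMap f (X.proj x) = Y.proj ⟨linMap f x, Aplus_le_comap f x.2⟩ := rfl

theorem tilde_mono (X : SubPair Λ) {C C' : Submodule Λ X.B} (h : C ≤ C') :
    X.tilde C ≤ X.tilde C' := by
  rintro _ ⟨x, hx, rfl⟩
  exact ⟨x, sup_le_sup_right (inf_le_inf_right _ h) _ hx, rfl⟩

theorem tilde_le_comap {X Y : SubPair Λ} (f : X ⟶ Y) {C : Submodule Λ X.B} {D : Submodule Λ Y.B}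
    (h : C ≤ D.comap (linMap f)) : X.tilde C ≤ (Y.tilde D).comap (totalMap f) := by
  rintro _ ⟨x, hx, rfl⟩
  refine ⟨⟨linMap f x, Aplus_le_comap f x.2⟩, ?_, rfl⟩
  have h' : C ⊓ X.Aplus ⊔ X.Aminus ≤ (D ⊓ Y.Aplus ⊔ Y.Aminus).comap (linMap f) :=
    sup_le (fun y hy => Submodule.mem_sup_left ⟨h hy.1, Aplus_le_comap f hy.2⟩)
      (fun y hy => Submodule.mem_sup_right (Aminus_le_comap f hy))
  exact h' hx

theorem finite_totalSpace (X : SubPair Λ) [IsNoetherianRing Λ] :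
    FiniteDimensional (ResidueField Λ) X.TotalSpace := by
  have : Module.Finite Λ X.TotalSpace := Module.Finite.of_surjective X.proj X.proj_surjective
  exact Module.Finite.of_restrictScalars_finite Λ _ _

end LocalRing

end SubPair

/-! ### Representations of posets -/

/-- A (finite dimensional) `k`-linear representation of a poset `P`: a finite dimensional total
space `V⁰` with subspaces `Vⁱ`, `i ∈ P`, such that `Vⁱ ⊆ Vʲ` whenever `i ≤ j`. -/
structure PosetRep (k : Type u) [Field k] (P : Type) [PartialOrder P] : Type (u + 1) where
  V : Type u
  [addCommGroup : AddCommGroup V]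
  [module : Module k V]
  [finite : FiniteDimensional k V]
  sub : P → Submodule k V
  mono : Monotone sub

namespace PosetRep

attribute [instance] PosetRep.addCommGroup PosetRep.module PosetRep.finite

variable {k : Type u} [Field k] {P : Type} [PartialOrder P]

/-- A morphism of representations is a linear map between the total spaces that respects the
subspaces. -/
@[ext]
structure Hom (V W : PosetRep k P) : Type u where
  lin : V.V →ₗ[k] W.V
  le_comap : ∀ i, V.sub i ≤ (W.sub i).comap lin

instance : Category (PosetRep k P) where
  Hom V W := Hom V W
  id _ := ⟨LinearMap.id, fun _ _ h => h⟩
  comp f g := ⟨g.lin ∘ₗ f.lin, fun i _ h => g.le_comap i (f.le_comap i h)⟩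

/-- The linear map between total spaces underlying a morphism of representations. -/
abbrev linMap {V W : PosetRep k P} (f : V ⟶ W) : V.V →ₗ[k] W.V := Hom.lin f

@[ext]
theorem hom_ext {V W : PosetRep k P} {f g : V ⟶ W} (h : linMap f = linMap g) : f = g :=
  Hom.ext h

/-- The linear maps respecting the subspaces, as an additive group. -/
def homSubgroup (V W : PosetRep k P) : AddSubgroup (V.V →ₗ[k] W.V) where
  carrier := {f | ∀ i, V.sub i ≤ (W.sub i).comap f}
  add_mem' hf hg i _ h := (W.sub i).add_mem (hf i h) (hg i h)
  zero_mem' i _ _ := (W.sub i).zero_mem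
  neg_mem' hf i _ h := (W.sub i).neg_mem (hf i h)

/-- Morphisms of representations as elements of `homSubgroup`. -/
def homEquiv (V W : PosetRep k P) : (V ⟶ W) ≃ homSubgroup V W where
  toFun f := ⟨Hom.lin f, Hom.le_comap f⟩
  invFun f := Hom.mk f.1 f.2

instance (V W : PosetRep k P) : AddCommGroup (V ⟶ W) := (homEquiv V W).addCommGroup

@[simp] theorem linMap_id (V : PosetRep k P) : linMap (𝟙 V) = LinearMap.id := rfl
@[simp] theorem linMap_comp {U V W : PosetRep k P} (f : U ⟶ V) (g : V ⟶ W) :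
    linMap (f ≫ g) = linMap g ∘ₗ linMap f := rfl
@[simp] theorem linMap_add {V W : PosetRep k P} (f g : V ⟶ W) :
    linMap (f + g) = linMap f + linMap g := rfl
@[simp] theorem linMap_zero {V W : PosetRep k P} : linMap (0 : V ⟶ W) = 0 := rfl

instance : Preadditive (PosetRep k P) where
  add_comp _ _ _ f g h := by ext; simp
  comp_add _ _ _ f g h := by ext; simp

end PosetRep

/-! ### The poset `P_n` -/

/-- The points of `P_n`: a chain of points `1, …, n - 1` and two further points `1'` and `1''`. -/
inductive ChainPoset (n : ℕ) : Type
  | chain (ℓ : ℕ) (h₁ : 1 ≤ ℓ) (h₂ : ℓ < n)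
  | prime
  | dprime

namespace ChainPoset

/-- The order on `P_n`: the chain is `n - 1 < ⋯ < 2 < 1`, so that `1` is its largest element,
and each of `1'`, `1''` is comparable only to itself. -/
inductive Le {n : ℕ} : ChainPoset n → ChainPoset n → Prop
  | chain (i j : ℕ) (hi₁ : 1 ≤ i) (hi₂ : i < n) (hj₁ : 1 ≤ j) (hj₂ : j < n) (h : j ≤ i) :
      Le (chain i hi₁ hi₂) (chain j hj₁ hj₂)
  | prime : Le prime prime
  | dprime : Le dprime dprime

instance (n : ℕ) : PartialOrder (ChainPoset n) where
  le := Le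
  le_refl x := by
    cases x with
    | chain ℓ h₁ h₂ => exact .chain _ _ _ _ _ _ le_rfl
    | prime => exact .prime
    | dprime => exact .dprime
  le_trans x y z hxy hyz := by
    cases hxy with
    | chain _ _ _ _ _ _ h =>
      cases hyz with
      | chain _ _ _ _ _ _ h' => exact .chain _ _ _ _ _ _ (h'.trans h)
    | prime => exact hyz
    | dprime => exact hyz
  le_antisymm x y hxy hyx := by
    cases hxy with
    | chain i j _ _ _ _ h =>
      cases hyx with
      | chain _ _ _ _ _ _ h' =>
        obtain rfl := le_antisymm h h'
        rfl
    | prime => rfl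
    | dprime => rfl

end ChainPoset

namespace PosetRep

variable {k : Type u} [Field k] {n : ℕ}

/-- The space `V^ℓ` of a representation of `P_n` for `0 ≤ ℓ ≤ n - 1`: the total space if `ℓ = 0`,
and the subspace at the chain point `ℓ` if `1 ≤ ℓ ≤ n - 1`. -/
def level (V : PosetRep k (ChainPoset n)) (ℓ : ℕ) : Submodule k V.V :=
  if h : 1 ≤ ℓ ∧ ℓ < n then V.sub (.chain ℓ h.1 h.2) else ⊤

/-- The objects of `rep'_k P_n`: the representations `V` with `V^{n-1} ⊆ V'` and
`V' + V'' = V⁰`. -/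
def isAdmissible (k : Type u) [Field k] (n : ℕ) : ObjectProperty (PosetRep k (ChainPoset n)) :=
  fun V => V.level (n - 1) ≤ V.sub .prime ∧ V.sub .prime ⊔ V.sub .dprime = ⊤

end PosetRep

/-! ### The functor `F` -/

section Functor

variable (Λ : Type u) [CommRing Λ] [IsLocalRing Λ] (n : ℕ) [IsUniserialOfLength Λ n]

variable {Λ} in
/-- The submodule of `B` attached to a point of `P_n`: `rad^ℓ B` at `ℓ`, `soc B` at `1'` and
`A` at `1''`. -/
def SubPair.pointSubmodule {n : ℕ} (X : SubPair Λ) : ChainPoset n → Submodule Λ X.B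
  | .chain ℓ _ _ => radPow ℓ ⊤
  | .prime => soc Λ X.B
  | .dprime => X.A

variable {Λ} in
/-- The representation of `P_n` attached to a pair `(B; A)`, with total space `A⁺ / A⁻` and
`V^ℓ = (rad^ℓ B)~`, `V' = (soc B)~`, `V'' = A~`. -/
def SubPair.toRep (X : SubPair Λ) : PosetRep (ResidueField Λ) (ChainPoset n) :=
  haveI := IsUniserialOfLength.isNoetherianRing Λ n
  haveI := X.finite_totalSpace
  { V := X.TotalSpace
    sub := fun i => X.tilde (X.pointSubmodule i)
    mono := fun i j h => by
      cases h with
      | chain i j _ _ _ _ h =>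
        exact X.tilde_mono (Submodule.smul_mono (Ideal.pow_le_pow_right h) le_rfl)
      | prime => exact le_rfl
      | dprime => exact le_rfl }

/-- The functor sending a pair to its representation of `P_n`, and a morphism
`f : (B; A) → (D; C)` to the map `A⁺ / A⁻ → C⁺ / C⁻` induced by `f`. -/
def repFunctor : SubPair Λ ⥤ PosetRep (ResidueField Λ) (ChainPoset n) where
  obj X := X.toRep n
  map f := PosetRep.Hom.mk (SubPair.totalMap f) (fun i => by
    cases i with
    | chain ℓ _ _ => exact SubPair.tilde_le_comap f (radPow_le_comap ℓ _ le_top)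
    | prime => exact SubPair.tilde_le_comap f (soc_le_comap _)
    | dprime => exact SubPair.tilde_le_comap f (SubPair.Hom.le_comap f))
  map_id X := PosetRep.hom_ext (LinearMap.ext fun x => by
    obtain ⟨x, rfl⟩ := X.proj_surjective x
    rfl)
  map_comp {X Y Z} f g := PosetRep.hom_ext (LinearMap.ext fun x => by
    obtain ⟨x, rfl⟩ := X.proj_surjective x
    rfl)

instance : (repFunctor Λ n).Additive where
  map_add {X Y f g} := PosetRep.hom_ext (LinearMap.ext fun x => by
    obtain ⟨x, rfl⟩ := X.proj_surjective x
    rfl)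

variable {Λ}

/-- The category `S_m(Λ)`: the pairs `(B; A)` with `p ^ m A = 0`. -/
abbrev BoundedPair (p : Λ) (m : ℕ) := (SubPair.bounded p m).FullSubcategory

/-- The functor `F : S_2(Λ) ⥤ rep_k P_n`. -/
abbrev functorF (p : Λ) : BoundedPair p 2 ⥤ PosetRep (ResidueField Λ) (ChainPoset n) :=
  (SubPair.bounded p 2).ι ⋙ repFunctor Λ n

end Functor

/-! ### The ideal `N` -/

section IdealN

variable {Λ : Type u} [CommRing Λ] [IsLocalRing Λ]

/-- The subgroup `N((B; A), (D; C))` of the morphisms `f` with `f(A + soc B) ⊆ rad C`. -/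
def idealN (p : Λ) (X Y : BoundedPair p 2) : AddSubgroup (X ⟶ Y) where
  carrier := {f | (X.obj.A ⊔ soc Λ X.obj.B).map (SubPair.linMap f.hom) ≤ rad Y.obj.A}
  add_mem' hf hg := by
    rintro _ ⟨x, hx, rfl⟩
    exact Submodule.add_mem _ (hf ⟨x, hx, rfl⟩) (hg ⟨x, hx, rfl⟩)
  zero_mem' := by
    rintro _ ⟨x, hx, rfl⟩
    exact Submodule.zero_mem _
  neg_mem' hf := by
    rintro _ ⟨x, hx, rfl⟩
    exact Submodule.neg_mem _ (hf ⟨x, hx, rfl⟩)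

theorem idealN_comp_left (p : Λ) {X Y Z : BoundedPair p 2} (f : X ⟶ Y) {g : Y ⟶ Z}
    (hg : g ∈ idealN p Y Z) : f ≫ g ∈ idealN p X Z := by
  rintro _ ⟨x, hx, rfl⟩
  exact hg ⟨_, SubPair.Aplus_le_comap f.hom hx, rfl⟩

theorem idealN_comp_right (p : Λ) {X Y Z : BoundedPair p 2} {f : X ⟶ Y} (g : Y ⟶ Z)
    (hf : f ∈ idealN p X Y) : f ≫ g ∈ idealN p X Z := by
  rintro _ ⟨x, hx, rfl⟩
  exact SubPair.Aminus_le_comap g.hom (hf ⟨x, hx, rfl⟩)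

/-- Two morphisms are congruent modulo `N` if their difference lies in `N`. -/
def relN (p : Λ) : HomRel (BoundedPair p 2) := fun X Y f g => f - g ∈ idealN p X Y

instance (p : Λ) : Congruence (relN p) where
  equivalence {X Y} :=
    { refl := fun f => by
        show f - f ∈ idealN p X Y
        rw [sub_self]
        exact zero_mem _
      symm := fun {f g} h => by
        show g - f ∈ idealN p X Y
        rw [← neg_sub]
        exact neg_mem h
      trans := fun {f g h} h₁ h₂ => by
        show f - h ∈ idealN p X Y
        rw [← sub_add_sub_cancel f g h]
        exact add_mem h₁ h₂ }
  comp_left {X Y Z} f {g g'} h := by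
    show f ≫ g - f ≫ g' ∈ idealN p X Z
    rw [← Preadditive.comp_sub]
    exact idealN_comp_left p f h
  comp_right {X Y Z f f'} g h := by
    show f ≫ g - f' ≫ g ∈ idealN p X Z
    rw [← Preadditive.sub_comp]
    exact idealN_comp_right p g h

/-- The factor category `S_2(Λ) / N`, with morphism groups `Hom(X, Y) / N(X, Y)`. -/
abbrev QuotientN (p : Λ) := CategoryTheory.Quotient (relN p)

instance (p : Λ) : Preadditive (QuotientN p) :=
  Quotient.preadditive (relN p) (fun X Y f₁ f₂ g₁ g₂ hf hg => by
    show f₁ + g₁ - (f₂ + g₂) ∈ idealN p X Y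
    rw [add_sub_add_comm]
    exact add_mem hf hg)

end IdealN

end

/-!
Submodules of `A⁺ / A⁻` remember the heights of elements: `x` has height at least `ℓ` if it lies in
`rad^ℓ B`. A morphism `h` between the representations of `(B; A)` and `(D; C)` lifts to a relation
between `A⁺` and `C⁺`, and since `h` respects the subspaces `V^ℓ`, `V'` and `V''`, the part of this
relation that fixes the values on `A⁻` does not decrease heights. Over a uniserial ring such a
relation can be enlarged one element at a time until it is defined on all of `A⁺`, and then on all
of `B`, where it is the graph of a linear map inducing `h`.

Conversely, an admissible representation `V` has a basis adapted both to the filtration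
`V⁰ ⊇ V¹ ⊇ ⋯ ⊇ V^{n-1} ⊇ 0` and to `V'`. A basis vector of height `d` is realised by `p ^ d` in
`Λ / (p ^ (d + c))`, where `c = 1` if the vector lies in `V'` and `c = 2` otherwise; the condition
`V^{n-1} ⊆ V'` says that `d + c ≤ n`.
-/

/-! ### Powers of a generator of the maximal ideal -/

section Generator

variable {Λ : Type u} [CommRing Λ] [IsLocalRing Λ] {p : Λ}

theorem isUnit_of_not_dvd (hp : maximalIdeal Λ = Ideal.span {p}) {c : Λ} (hc : ¬p ∣ c) :
    IsUnit c := by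
  rwa [← Ideal.mem_span_singleton, ← hp, notMem_maximalIdeal] at hc

theorem dvd_of_pow_succ_dvd_pow_mul (hp : maximalIdeal Λ = Ideal.span {p}) {a : ℕ} {c : Λ}
    (ha : p ^ a ≠ 0) (h : p ^ (a + 1) ∣ p ^ a * c) : p ∣ c := by
  obtain ⟨d, hd⟩ := h
  have hzero : p ^ a * (c - p * d) = 0 := by linear_combination hd
  have hdvd : p ∣ c - p * d :=
    by_contra fun h => ha ((isUnit_of_not_dvd hp h).mul_left_eq_zero.mp hzero)
  exact (dvd_sub_left (dvd_mul_right p d)).mp hdvd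

theorem covBy_span_pow (hp : maximalIdeal Λ = Ideal.span {p}) {j : ℕ} (hj : p ^ j ≠ 0) :
    Ideal.span {p ^ (j + 1)} ⋖ Ideal.span {p ^ j} := by
  refine ⟨lt_of_le_not_ge ?_ fun h => ?_, fun I hI hI' => ?_⟩
  · exact Ideal.span_singleton_le_span_singleton.mpr (pow_dvd_pow p j.le_succ)
  · have hp1 : p ∣ 1 := dvd_of_pow_succ_dvd_pow_mul hp hj <| by
      rwa [mul_one, ← Ideal.span_singleton_le_span_singleton]
    have hpm : p ∈ maximalIdeal Λ := hp ▸ Ideal.mem_span_singleton_self p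
    exact hpm (isUnit_of_dvd_one hp1)
  · obtain ⟨x, hxI, hx⟩ := SetLike.exists_of_lt hI
    obtain ⟨c, rfl⟩ := Ideal.mem_span_singleton.mp (hI'.le hxI)
    have hc : IsUnit c := isUnit_of_not_dvd hp fun hc =>
      hx (Ideal.mem_span_singleton.mpr (pow_succ p j ▸ mul_dvd_mul_left _ hc))
    exact hI'.not_ge ((Ideal.span_singleton_le_iff_mem _).mpr
      ((Ideal.mul_unit_mem_iff_mem I hc).mp hxI))

theorem length_eq_of_pow_eq_zero (hp : maximalIdeal Λ = Ideal.span {p}) {N : ℕ}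
    (hN : p ^ N = 0) (hmin : ∀ j < N, p ^ j ≠ 0) : Module.length Λ Λ = N := by
  let s : CompositionSeries (Ideal Λ) :=
    { length := N
      toFun i := Ideal.span {p ^ (N - i : ℕ)}
      step i := by
        have h : N - i = N - (i + 1) + 1 := by omega
        change Ideal.span {p ^ (N - i : ℕ)} ⋖ Ideal.span {p ^ (N - (i + 1) : ℕ)}
        rw [h]
        exact covBy_span_pow hp (hmin _ (by omega)) }
  refine (Module.length_compositionSeries s ?_ ?_).symm
  · change Ideal.span {p ^ (N - 0 : ℕ)} = ⊥
    rw [Nat.sub_zero, hN, Ideal.span_singleton_zero]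
  · change Ideal.span {p ^ (N - N : ℕ)} = ⊤
    rw [Nat.sub_self, pow_zero, Ideal.span_singleton_one]

theorem isNilpotent_generator (n : ℕ) [h : IsUniserialOfLength Λ n]
    (hp : maximalIdeal Λ = Ideal.span {p}) : IsNilpotent p := by
  have hlen : Module.length Λ Λ ≠ ⊤ := h.length_eq ▸ ENat.natCast_ne_top n
  have : IsArtinianRing Λ :=
    (isFiniteLength_iff_isNoetherian_isArtinian.mp (Module.length_ne_top_iff.mp hlen)).2
  obtain ⟨m, hm⟩ := IsArtinianRing.isNilpotent_jacobson_bot (R := Λ)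
  rw [IsLocalRing.jacobson_eq_maximalIdeal _ bot_ne_top, hp, Ideal.span_singleton_pow] at hm
  exact ⟨m, Ideal.span_singleton_eq_bot.mp hm⟩

theorem pow_eq_zero_iff_length_le (n : ℕ) [h : IsUniserialOfLength Λ n]
    (hp : maximalIdeal Λ = Ideal.span {p}) {j : ℕ} : p ^ j = 0 ↔ n ≤ j := by
  classical
  have hex : ∃ N, p ^ N = 0 := isNilpotent_generator n hp
  have hlen := length_eq_of_pow_eq_zero hp (Nat.find_spec hex) fun _ => Nat.find_min hex
  rw [h.length_eq, Nat.cast_inj] at hlen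
  rw [hlen]
  exact ⟨Nat.find_min' hex, fun hj => pow_eq_zero_of_le hj (Nat.find_spec hex)⟩

theorem length_pos (n : ℕ) [IsUniserialOfLength Λ n]
    (hp : maximalIdeal Λ = Ideal.span {p}) : 0 < n := by
  have h0 : p ^ 0 ≠ 0 := by rw [pow_zero]; exact one_ne_zero
  rwa [Ne, pow_eq_zero_iff_length_le n hp, not_le] at h0

theorem pow_add_dvd_pow_mul_iff (n : ℕ) [IsUniserialOfLength Λ n]
    (hp : maximalIdeal Λ = Ideal.span {p}) {a b : ℕ} (hab : a + b ≤ n) {c : Λ} :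
    p ^ (a + b) ∣ p ^ a * c ↔ p ^ b ∣ c := by
  refine ⟨fun h => ?_, fun h => pow_add p a b ▸ mul_dvd_mul_left _ h⟩
  induction b with
  | zero => simp
  | succ b ih =>
    obtain ⟨d, rfl⟩ := ih (by omega) ((pow_dvd_pow p (by omega)).trans h)
    have hd : p ∣ d := by
      refine dvd_of_pow_succ_dvd_pow_mul hp (a := a + b) ?_ ?_
      · rw [Ne, pow_eq_zero_iff_length_le n hp]
        omega
      · rwa [pow_add p a b, mul_assoc]
    exact pow_succ p b ▸ mul_dvd_mul_left _ hd

end Generator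

/-! ### Radical layers and socle in terms of the generator -/

section Membership

variable {Λ : Type u} [CommRing Λ] [IsLocalRing Λ] {p : Λ}
variable {M : Type u} [AddCommGroup M] [Module Λ M] {U : Submodule Λ M} {x : M}

theorem mem_radPow_iff (hp : maximalIdeal Λ = Ideal.span {p}) {ℓ : ℕ} :
    x ∈ radPow ℓ U ↔ ∃ y ∈ U, p ^ ℓ • y = x := by
  rw [radPow, hp, Ideal.span_singleton_pow, Submodule.ideal_span_singleton_smul]
  exact Submodule.mem_smul_pointwise_iff_exists _ _ _

theorem mem_rad_iff (hp : maximalIdeal Λ = Ideal.span {p}) :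
    x ∈ rad U ↔ ∃ y ∈ U, p • y = x := by
  rw [rad, hp, Submodule.ideal_span_singleton_smul]
  exact Submodule.mem_smul_pointwise_iff_exists _ _ _

theorem mem_soc_iff_smul_eq_zero (hp : maximalIdeal Λ = Ideal.span {p}) :
    x ∈ soc Λ M ↔ p • x = 0 := by
  rw [mem_soc_iff]
  refine ⟨fun h => h p (hp ▸ Ideal.mem_span_singleton_self p), fun h r hr => ?_⟩
  obtain ⟨c, rfl⟩ := Ideal.mem_span_singleton.mp (hp ▸ hr)
  rw [mul_comm, mul_smul, h, smul_zero]

theorem radPow_antitone (U : Submodule Λ M) : Antitone fun ℓ => radPow ℓ U :=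
  fun _ _ h => Submodule.smul_mono (Ideal.pow_le_pow_right h) le_rfl

theorem radPow_zero (U : Submodule Λ M) : radPow 0 U = U := by
  rw [radPow, pow_zero, Ideal.one_eq_top, Submodule.top_smul]

theorem radPow_succ (ℓ : ℕ) (U : Submodule Λ M) : radPow (ℓ + 1) U = rad (radPow ℓ U) := by
  rw [radPow, pow_succ', mul_smul]
  rfl

theorem radPow_eq_bot (hp : maximalIdeal Λ = Ideal.span {p}) {N : ℕ} (hN : p ^ N = 0)
    (U : Submodule Λ M) : radPow N U = ⊥ := by
  rw [radPow, hp, Ideal.span_singleton_pow, hN, Ideal.span_singleton_zero, Submodule.bot_smul]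

end Membership

/-! ### Extending relations that do not decrease heights -/

section Height

theorem exists_lt_forall_mem_iff_le {R M : Type*} [Semiring R] [AddCommMonoid M] [Module R M]
    {F : ℕ → Submodule R M} (hF : Antitone F) (hzero : F 0 = ⊤) {N : ℕ} (hN : F N = ⊥) {v : M}
    (hv : v ≠ 0) : ∃ d < N, ∀ j, v ∈ F j ↔ j ≤ d := by
  classical
  have hlt : ∀ j, v ∈ F j → j < N := fun j hj => by
    by_contra! h
    exact hv ((Submodule.mem_bot R).mp (hN ▸ hF h hj))
  have hmem : v ∈ F (Nat.findGreatest (fun j => v ∈ F j) N) :=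
    Nat.findGreatest_spec (P := fun j => v ∈ F j) N.zero_le (hzero ▸ Submodule.mem_top)
  exact ⟨_, hlt _ hmem, fun j =>
    ⟨fun hj => Nat.le_findGreatest (hlt j hj).le hj, fun hj => hF hj hmem⟩⟩

theorem exists_mem_notMem_smul_mem {R M : Type*} [Semiring R] [AddCommMonoid M] [Module R M]
    {p : R} (hp : IsNilpotent p) {U W : Submodule R M} (hUW : ¬W ≤ U) :
    ∃ x ∈ W, x ∉ U ∧ p • x ∈ U := by
  classical
  obtain ⟨x, hxW, hxU⟩ := SetLike.not_le_iff_exists.mp hUW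
  have hex : ∃ j, p ^ j • x ∈ U := hp.imp fun N hN => by rw [hN, zero_smul]; exact U.zero_mem
  obtain ⟨j, hj⟩ := Nat.exists_eq_succ_of_ne_zero (n := Nat.find hex) fun h => hxU <| by
    simpa only [h, pow_zero, one_smul] using Nat.find_spec hex
  refine ⟨p ^ j • x, W.smul_mem _ hxW, Nat.find_min hex (by omega), ?_⟩
  rw [smul_smul, ← pow_succ', ← Nat.succ_eq_add_one, ← hj]
  exact Nat.find_spec hex

variable {Λ : Type u} [CommRing Λ] [IsLocalRing Λ] {p : Λ}
variable {B D : Type u} [AddCommGroup B] [Module Λ B] [AddCommGroup D] [Module Λ D]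

theorem exists_sub_mem_forall_height_le (hp : maximalIdeal Λ = Ideal.span {p})
    (hnil : IsNilpotent p) {U : Submodule Λ B} {x : B} (hx : x ∉ U) :
    ∃ y, y - x ∈ U ∧ ∃ r, y ∈ radPow r (⊤ : Submodule Λ B) ∧
      ∀ u ∈ U, ∀ ℓ, y + u ∈ radPow ℓ (⊤ : Submodule Λ B) → ℓ ≤ r := by
  obtain ⟨N, hN⟩ := hnil
  obtain ⟨r, -, hr⟩ := exists_lt_forall_mem_iff_le (radPow_antitone (⊤ : Submodule Λ (B ⧸ U)))
    (radPow_zero _) (radPow_eq_bot hp hN _) (v := U.mkQ x)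
    fun h => hx ((Submodule.Quotient.mk_eq_zero U).mp h)
  obtain ⟨v, -, hv⟩ := (mem_radPow_iff hp).mp ((hr r).mpr le_rfl)
  obtain ⟨z, rfl⟩ := U.mkQ_surjective v
  have hyx : U.mkQ (p ^ r • z) = U.mkQ x := (map_smul _ _ _).trans hv
  refine ⟨p ^ r • z, (Submodule.Quotient.eq U).mp hyx, r,
    (mem_radPow_iff hp).mpr ⟨z, Submodule.mem_top, rfl⟩, fun u hu ℓ hℓ => (hr ℓ).mp ?_⟩
  have hmk : U.mkQ (p ^ r • z + u) = U.mkQ x := by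
    rw [map_add, hyx, add_eq_left]
    exact (Submodule.Quotient.mk_eq_zero U).mpr hu
  exact hmk ▸ radPow_le_comap ℓ U.mkQ le_top hℓ

/-- A linear relation between `B` and `D` that does not decrease heights: if `b ∈ rad^ℓ B` is
related to `d`, then `d ∈ rad^ℓ D`. For the graph of a linear map this is automatic; for the
graph of a map defined on a submodule of `B` it is the obstruction to extending the map to `B`. -/
def IsHeightMono (G : Submodule Λ (B × D)) : Prop :=
  ∀ z ∈ G, ∀ ℓ, z.1 ∈ radPow ℓ (⊤ : Submodule Λ B) → z.2 ∈ radPow ℓ (⊤ : Submodule Λ D)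

namespace IsHeightMono

variable {G : Submodule Λ (B × D)}

theorem sup_span (hp : maximalIdeal Λ = Ideal.span {p}) (hG : IsHeightMono G) {x : B} {y : D}
    {r : ℕ} (hmax : ∀ g ∈ G, ∀ ℓ, x + g.1 ∈ radPow ℓ (⊤ : Submodule Λ B) → ℓ ≤ r)
    (hx : x ∈ radPow r (⊤ : Submodule Λ B)) (hy : y ∈ radPow r (⊤ : Submodule Λ D))
    (hxy : p • (x, y) ∈ G) : IsHeightMono (G ⊔ Submodule.span Λ {(x, y)}) := by
  intro z hz ℓ hzℓ
  obtain ⟨g, hg, w, hw, rfl⟩ := Submodule.mem_sup.mp hz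
  obtain ⟨c, rfl⟩ := Submodule.mem_span_singleton.mp hw
  by_cases hc : p ∣ c
  · obtain ⟨d, rfl⟩ := hc
    refine hG _ (G.add_mem hg ?_) ℓ hzℓ
    rw [mul_comm, mul_smul]
    exact G.smul_mem d hxy
  · obtain ⟨v, rfl⟩ := isUnit_of_not_dvd hp hc
    have hℓr : ℓ ≤ r := by
      refine hmax _ (G.smul_mem (↑v⁻¹ : Λ) hg) ℓ ?_
      simpa [smul_smul, add_comm] using Submodule.smul_mem _ (↑v⁻¹ : Λ) hzℓ
    have hxℓ : (v : Λ) • x ∈ radPow ℓ (⊤ : Submodule Λ B) :=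
      Submodule.smul_mem _ _ (radPow_antitone _ hℓr hx)
    have hgℓ : g.1 ∈ radPow ℓ (⊤ : Submodule Λ B) := (Submodule.add_mem_iff_left _ hxℓ).mp hzℓ
    exact add_mem (hG g hg ℓ hgℓ) (Submodule.smul_mem _ _ (radPow_antitone _ hℓr hy))

theorem exists_le_maximal {R : Submodule Λ (B × D)} (hG : IsHeightMono G) (hle : G ≤ R) :
    ∃ G', G ≤ G' ∧ Maximal (fun H => IsHeightMono H ∧ H ≤ R) G' := by
  refine zorn_le_nonempty₀ {H | IsHeightMono H ∧ H ≤ R} (fun c hc hchain H₀ hH₀ => ?_) G ⟨hG, hle⟩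
  refine ⟨sSup c, ⟨fun z hz => ?_, sSup_le fun H hH => (hc hH).2⟩, fun H hH => le_sSup hH⟩
  obtain ⟨H, hH, hzH⟩ := (Submodule.mem_sSup_of_directed ⟨H₀, hH₀⟩ hchain.directedOn).mp hz
  exact (hc hH).1 z hzH

theorem exists_extension (hp : maximalIdeal Λ = Ideal.span {p}) (hnil : IsNilpotent p)
    {G₀ R : Submodule Λ (B × D)} (hG₀ : IsHeightMono G₀) (hle : G₀ ≤ R)
    (hstep : ∀ G, IsHeightMono G → G₀ ≤ G →
      ∀ x ∈ R.map (LinearMap.fst Λ B D), p • x ∈ G.map (LinearMap.fst Λ B D) →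
      ∀ r, x ∈ radPow r (⊤ : Submodule Λ B) →
      ∃ y ∈ radPow r (⊤ : Submodule Λ D), (x, y) ∈ R ∧ p • (x, y) ∈ G) :
    ∃ G, IsHeightMono G ∧ G₀ ≤ G ∧ G ≤ R ∧
      R.map (LinearMap.fst Λ B D) ≤ G.map (LinearMap.fst Λ B D) := by
  obtain ⟨G, hG₀G, hGmax⟩ := hG₀.exists_le_maximal hle
  obtain ⟨hG, hGR⟩ := hGmax.prop
  refine ⟨G, hG, hG₀G, hGR, by_contra fun hdom => ?_⟩
  set U := G.map (LinearMap.fst Λ B D)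
  obtain ⟨x₀, hx₀R, hx₀U, hpx₀⟩ := exists_mem_notMem_smul_mem hnil hdom
  obtain ⟨x, hxx₀, r, hxr, hmax⟩ := exists_sub_mem_forall_height_le hp hnil hx₀U
  have hxU : x ∉ U := fun h => hx₀U ((sub_mem_comm_iff.trans (U.sub_mem_iff_left h)).mp hxx₀)
  have hxR : x ∈ R.map (LinearMap.fst Λ B D) :=
    (Submodule.sub_mem_iff_left _ hx₀R).mp (Submodule.map_mono hGR hxx₀)
  have hpx : p • x ∈ U :=
    (U.sub_mem_iff_left hpx₀).mp (smul_sub p x x₀ ▸ U.smul_mem p hxx₀)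
  obtain ⟨y, hyr, hxyR, hpxy⟩ := hstep G hG hG₀G x hxR hpx r hxr
  have hext := hG.sup_span hp (fun g hg => hmax g.1 ⟨g, hg, rfl⟩) hxr hyr hpxy
  have hextR : G ⊔ Submodule.span Λ {(x, y)} ≤ R :=
    sup_le hGR ((Submodule.span_singleton_le_iff_mem _ _).mpr hxyR)
  have hxyG : (x, y) ∈ G := hGmax.le_of_ge ⟨hext, hextR⟩ le_sup_left
    (Submodule.mem_sup_right (Submodule.mem_span_singleton_self _))
  exact hxU ⟨_, hxyG, rfl⟩

theorem exists_linearMap (hp : maximalIdeal Λ = Ideal.span {p}) (hnil : IsNilpotent p)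
    (hG : IsHeightMono G) : ∃ f : B →ₗ[Λ] D, ∀ z ∈ G, f z.1 = z.2 := by
  obtain ⟨H, hH, hGH, -, hdom⟩ := hG.exists_extension hp hnil (R := ⊤) le_top <| by
    rintro H hH - x - ⟨⟨-, d⟩, hzH, rfl⟩ r hxr
    have hd : d ∈ radPow (r + 1) (⊤ : Submodule Λ D) := hH _ hzH _ <| by
      rw [radPow_succ]
      exact (mem_rad_iff hp).mpr ⟨x, hxr, rfl⟩
    rw [radPow_succ] at hd
    obtain ⟨y, hyr, rfl⟩ := (mem_rad_iff hp).mp hd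
    exact ⟨y, hyr, Submodule.mem_top, hzH⟩
  have hfun : ∀ z ∈ H, z.1 = 0 → z.2 = 0 := fun z hz hz0 => by
    obtain ⟨N, hN⟩ := hnil
    have hzN := hH z hz N (hz0 ▸ Submodule.zero_mem _)
    rwa [radPow_eq_bot hp hN, Submodule.mem_bot] at hzN
  have htop : H.map (LinearMap.fst Λ B D) = ⊤ := top_le_iff.mp <| hdom.trans' <| by
    rw [Submodule.map_top, LinearMap.range_eq_top.mpr LinearMap.fst_surjective]
  refine ⟨H.toLinearPMap.toFun ∘ₗ (LinearEquiv.ofTop _ htop).symm.toLinearMap, fun z hz => ?_⟩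
  have hz' := H.mem_graph_toLinearPMap hfun ⟨z.1, htop ▸ Submodule.mem_top⟩
  exact sub_eq_zero.mp (hfun _ (H.sub_mem hz' (hGH hz)) (sub_self z.1))

end IsHeightMono

end Height

/-! ### Morphisms of pairs inducing a given map of total spaces -/

namespace SubPair

variable {Λ : Type u} [CommRing Λ] [IsLocalRing Λ] {p : Λ} {X Y : SubPair Λ}

theorem residue_smul_totalSpace (r : Λ) (v : X.TotalSpace) : residue Λ r • v = r • v := by
  rw [← IsLocalRing.ResidueField.algebraMap_eq, algebraMap_smul]

theorem proj_mem_tilde_iff {x : X.Aplus} {C : Submodule Λ X.B} :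
    X.proj x ∈ X.tilde C ↔ (x : X.B) ∈ C ⊔ X.Aminus := by
  have hmem : X.proj x ∈ X.tilde C ↔ (x : X.B) ∈ C ⊓ X.Aplus ⊔ X.Aminus := by
    refine ⟨?_, fun h => ⟨x, h, rfl⟩⟩
    rintro ⟨y, hy, hyx⟩
    have hxy : ((x - y : X.Aplus) : X.B) ∈ X.Aminus := by
      rw [← proj_eq_zero_iff, map_sub, hyx, sub_self]
    exact sub_add_cancel (x : X.B) y ▸ add_mem (Submodule.mem_sup_right hxy) hy
  rw [hmem, sup_comm, ← sup_inf_assoc_of_le C X.Aminus_le_Aplus, sup_comm]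
  exact and_iff_left x.2

theorem proj_mem_tilde {x : X.Aplus} {C : Submodule Λ X.B} (hx : (x : X.B) ∈ C) :
    X.proj x ∈ X.tilde C :=
  proj_mem_tilde_iff.mpr (Submodule.mem_sup_left hx)

theorem exists_proj_eq_of_mem_tilde {v : X.TotalSpace} {C : Submodule Λ X.B}
    (hv : v ∈ X.tilde C) : ∃ x : X.Aplus, (x : X.B) ∈ C ∧ X.proj x = v := by
  obtain ⟨x, rfl⟩ := X.proj_surjective v
  obtain ⟨c, hc, a, ha, hca⟩ := Submodule.mem_sup.mp (proj_mem_tilde_iff.mp hv)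
  have hax : X.proj ⟨a, X.Aminus_le_Aplus ha⟩ = 0 := (X.proj_eq_zero_iff _).mpr ha
  refine ⟨x - ⟨a, X.Aminus_le_Aplus ha⟩, ?_, by rw [map_sub, hax, sub_zero]⟩
  rwa [Submodule.coe_sub, ← hca, add_sub_cancel_right]

theorem tilde_top : X.tilde ⊤ = ⊤ :=
  eq_top_iff.mpr fun v _ => by
    obtain ⟨x, rfl⟩ := X.proj_surjective v
    exact proj_mem_tilde Submodule.mem_top

theorem tilde_bot : X.tilde ⊥ = ⊥ :=
  eq_bot_iff.mpr fun v hv => by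
    obtain ⟨x, hx, rfl⟩ := exists_proj_eq_of_mem_tilde hv
    exact (X.proj_eq_zero_iff x).mpr (hx ▸ X.Aminus.zero_mem)

theorem Aminus_le_soc (hp : maximalIdeal Λ = Ideal.span {p}) (hX : bounded p 2 X) :
    X.Aminus ≤ soc Λ X.B := fun x hx => by
  obtain ⟨a, ha, rfl⟩ := (mem_rad_iff hp).mp hx
  rw [mem_soc_iff_smul_eq_zero hp, smul_smul, ← sq]
  exact hX a ha

theorem rad_Aplus : rad X.Aplus = X.Aminus :=
  le_antisymm (Submodule.smul_le.mpr fun _ hr _ hx => X.smul_mem_Aminus hr hx)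
    (Submodule.smul_mono le_rfl le_sup_left)

theorem mem_Aplus_of_smul_eq (hp : maximalIdeal Λ = Ideal.span {p}) {x b : X.B}
    (hx : x ∈ X.Aplus) (hxb : p • x = p • b) : b ∈ X.Aplus := by
  have hsoc : b - x ∈ soc Λ X.B := by
    rw [mem_soc_iff_smul_eq_zero hp, smul_sub, hxb, sub_self]
  exact sub_add_cancel b x ▸ add_mem (Submodule.mem_sup_right hsoc) hx

/-- The relation between `B` and `D` consisting of the pairs in `A⁺ × C⁺` whose classes in
`A⁺ / A⁻` and `C⁺ / C⁻` correspond under `h`. A morphism `f : (B; A) → (D; C)` induces `h` if and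
only if `x` is related to `f x` for all `x ∈ A⁺`. -/
noncomputable def liftRelation (h : X.TotalSpace →ₗ[ResidueField Λ] Y.TotalSpace) :
    Submodule Λ (X.B × Y.B) :=
  (LinearMap.eqLocus (h.restrictScalars Λ ∘ₗ X.proj ∘ₗ LinearMap.fst Λ X.Aplus Y.Aplus)
    (Y.proj ∘ₗ LinearMap.snd Λ X.Aplus Y.Aplus)).map (X.Aplus.subtype.prodMap Y.Aplus.subtype)

variable {h : X.TotalSpace →ₗ[ResidueField Λ] Y.TotalSpace}

theorem mem_liftRelation_iff {z : X.B × Y.B} :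
    z ∈ liftRelation h ↔
      ∃ x : X.Aplus, ∃ y : Y.Aplus, h (X.proj x) = Y.proj y ∧ ((x : X.B), (y : Y.B)) = z :=
  ⟨fun ⟨w, hw, hwz⟩ => ⟨w.1, w.2, hw, hwz⟩, fun ⟨x, y, hxy, hz⟩ => ⟨(x, y), hxy, hz⟩⟩

theorem exists_mem_liftRelation (x : X.Aplus) {C : Submodule Λ Y.B}
    (hx : h (X.proj x) ∈ Y.tilde C) : ∃ y ∈ C, ((x : X.B), y) ∈ liftRelation h := by
  obtain ⟨y, hy, hyx⟩ := exists_proj_eq_of_mem_tilde hx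
  exact ⟨y, hy, mem_liftRelation_iff.mpr ⟨x, y, hyx.symm, rfl⟩⟩

theorem map_fst_liftRelation : (liftRelation h).map (LinearMap.fst Λ X.B Y.B) = X.Aplus := by
  ext x
  constructor
  · rintro ⟨z, hz, rfl⟩
    obtain ⟨x, y, -, rfl⟩ := mem_liftRelation_iff.mp hz
    exact x.2
  · intro hx
    obtain ⟨y, hy⟩ := Y.proj_surjective (h (X.proj ⟨x, hx⟩))
    exact ⟨(x, y), mem_liftRelation_iff.mpr ⟨⟨x, hx⟩, y, hy.symm, rfl⟩, rfl⟩

theorem smul_snd_eq_zero_of_mem_liftRelation (hp : maximalIdeal Λ = Ideal.span {p})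
    (hY : bounded p 2 Y) (hsoc : X.tilde (soc Λ X.B) ≤ (Y.tilde (soc Λ Y.B)).comap h)
    {z : X.B × Y.B} (hz : z ∈ liftRelation h) (hz₁ : p • z.1 = 0) : p • z.2 = 0 := by
  obtain ⟨x, y, hxy, rfl⟩ := mem_liftRelation_iff.mp hz
  have hx : h (X.proj x) ∈ Y.tilde (soc Λ Y.B) :=
    hsoc (proj_mem_tilde ((mem_soc_iff_smul_eq_zero hp).mpr hz₁))
  rw [hxy, proj_mem_tilde_iff, sup_eq_left.mpr (Aminus_le_soc hp hY)] at hx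
  exact (mem_soc_iff_smul_eq_zero hp).mp hx

theorem isHeightMono_rad_liftRelation (hp : maximalIdeal Λ = Ideal.span {p}) (hY : bounded p 2 Y)
    (hrad : ∀ ℓ, X.tilde (radPow ℓ ⊤) ≤ (Y.tilde (radPow ℓ ⊤)).comap h)
    (hsoc : X.tilde (soc Λ X.B) ≤ (Y.tilde (soc Λ Y.B)).comap h) :
    IsHeightMono (rad (liftRelation h)) := by
  intro w hw ℓ hwℓ
  obtain ⟨z, hz, rfl⟩ := (mem_rad_iff hp).mp hw
  cases ℓ with
  | zero => exact (radPow_zero (⊤ : Submodule Λ Y.B)).symm ▸ Submodule.mem_top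
  | succ r =>
    rw [radPow_succ] at hwℓ ⊢
    obtain ⟨b, hbr, hb⟩ := (mem_rad_iff hp).mp hwℓ
    have hz₁ : z.1 ∈ X.Aplus := map_fst_liftRelation (h := h) ▸ ⟨z, hz, rfl⟩
    have hbA : b ∈ X.Aplus := mem_Aplus_of_smul_eq hp hz₁ hb.symm
    obtain ⟨y, hyr, hby⟩ := exists_mem_liftRelation ⟨b, hbA⟩ (hrad r (proj_mem_tilde hbr))
    have hyz : p • (y - z.2) = 0 :=
      smul_snd_eq_zero_of_mem_liftRelation hp hY hsoc (sub_mem hby hz)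
        ((smul_sub p b z.1).trans (sub_eq_zero.mpr hb))
    exact (mem_rad_iff hp).mpr ⟨y, hyr, sub_eq_zero.mp ((smul_sub p y z.2).symm.trans hyz)⟩

theorem exists_linearMap_mem_liftRelation (hp : maximalIdeal Λ = Ideal.span {p})
    (hnil : IsNilpotent p) (hY : bounded p 2 Y)
    (hrad : ∀ ℓ, X.tilde (radPow ℓ ⊤) ≤ (Y.tilde (radPow ℓ ⊤)).comap h)
    (hsoc : X.tilde (soc Λ X.B) ≤ (Y.tilde (soc Λ Y.B)).comap h) :
    ∃ f : X.B →ₗ[Λ] Y.B, ∀ x ∈ X.Aplus, (x, f x) ∈ liftRelation h := by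
  obtain ⟨G, hG, -, hGR, hdom⟩ := (isHeightMono_rad_liftRelation hp hY hrad hsoc).exists_extension
    hp hnil (rad_le _) fun G _ hG₀ x hx _ r hxr => by
      rw [map_fst_liftRelation] at hx
      obtain ⟨y, hyr, hxy⟩ := exists_mem_liftRelation ⟨x, hx⟩ (hrad r (proj_mem_tilde hxr))
      exact ⟨y, hyr, hxy, hG₀ ((mem_rad_iff hp).mpr ⟨_, hxy, rfl⟩)⟩
  obtain ⟨f, hf⟩ := hG.exists_linearMap hp hnil
  refine ⟨f, fun x hx => ?_⟩
  rw [← map_fst_liftRelation (h := h)] at hx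
  obtain ⟨z, hz, rfl⟩ := hdom hx
  exact (Prod.ext rfl (hf z hz).symm : z = (z.1, f z.1)) ▸ hGR hz

theorem exists_totalMap_eq (hp : maximalIdeal Λ = Ideal.span {p}) (hnil : IsNilpotent p)
    (hY : bounded p 2 Y) (hrad : ∀ ℓ, X.tilde (radPow ℓ ⊤) ≤ (Y.tilde (radPow ℓ ⊤)).comap h)
    (hsoc : X.tilde (soc Λ X.B) ≤ (Y.tilde (soc Λ Y.B)).comap h)
    (hA : X.tilde X.A ≤ (Y.tilde Y.A).comap h) : ∃ f : X ⟶ Y, totalMap f = h := by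
  obtain ⟨f, hf⟩ := exists_linearMap_mem_liftRelation hp hnil hY hrad hsoc
  have hproj : ∀ x : X.Aplus, ∃ hfx : f x ∈ Y.Aplus, h (X.proj x) = Y.proj ⟨f x, hfx⟩ := by
    intro x
    obtain ⟨x', y, hxy, he⟩ := mem_liftRelation_iff.mp (hf x x.2)
    obtain ⟨hx, hy⟩ := Prod.mk.inj he
    obtain rfl := Subtype.ext hx
    exact ⟨hy ▸ y.2, hxy.trans (congrArg Y.proj (Subtype.ext hy))⟩
  have hfA : X.A ≤ Y.A.comap f := fun a ha => by
    have hAminus : Y.Aminus ≤ Y.A := rad_le Y.A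
    obtain ⟨hfa, hfa_proj⟩ := hproj ⟨a, Submodule.mem_sup_left ha⟩
    have hfaA : Y.proj ⟨f a, hfa⟩ ∈ Y.tilde Y.A := hfa_proj ▸ hA (proj_mem_tilde ha)
    rwa [proj_mem_tilde_iff, sup_eq_left.mpr hAminus] at hfaA
  refine ⟨Hom.mk f hfA, LinearMap.ext fun v => ?_⟩
  obtain ⟨x, rfl⟩ := X.proj_surjective v
  exact (hproj x).2.symm

end SubPair

/-! ### The filtration of a representation by its chain -/

namespace PosetRep

variable {k : Type u} [Field k] {n : ℕ} {V W : PosetRep k (ChainPoset n)}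

/-- The descending filtration `V⁰ ⊇ V¹ ⊇ ⋯ ⊇ V^{n-1} ⊇ 0` of a representation of `P_n`, extended
by zero in degrees at least `n`. -/
noncomputable def filtration (V : PosetRep k (ChainPoset n)) (ℓ : ℕ) : Submodule k V.V :=
  if ℓ < n then V.level ℓ else ⊥

theorem filtration_zero (hn : 0 < n) : V.filtration 0 = ⊤ := by
  rw [filtration, if_pos hn, level, dif_neg (by omega)]

theorem filtration_of_le {ℓ : ℕ} (h : n ≤ ℓ) : V.filtration ℓ = ⊥ :=
  if_neg h.not_gt

theorem filtration_eq_sub {ℓ : ℕ} (h₁ : 1 ≤ ℓ) (h₂ : ℓ < n) :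
    V.filtration ℓ = V.sub (.chain ℓ h₁ h₂) := by
  rw [filtration, if_pos h₂, level, dif_pos ⟨h₁, h₂⟩]

theorem filtration_antitone : Antitone V.filtration := by
  intro i j hij
  obtain hj | hj := le_or_gt n j
  · rw [filtration_of_le hj]
    exact bot_le
  obtain rfl | hi := Nat.eq_zero_or_pos i
  · rw [filtration_zero (by omega)]
    exact le_top
  rw [filtration_eq_sub hi (by omega), filtration_eq_sub (by omega) hj]
  exact V.mono (.chain j i _ _ _ _ hij)

theorem filtration_le_comap (f : V ⟶ W) (ℓ : ℕ) :
    V.filtration ℓ ≤ (W.filtration ℓ).comap (linMap f) := by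
  obtain hℓ | hℓ := le_or_gt n ℓ
  · rw [filtration_of_le hℓ]
    exact bot_le
  obtain rfl | hℓ₀ := Nat.eq_zero_or_pos ℓ
  · rw [filtration_zero (V := W) hℓ]
    exact le_top
  rw [filtration_eq_sub hℓ₀ hℓ, filtration_eq_sub hℓ₀ hℓ]
  exact Hom.le_comap f _

end PosetRep

section FiltrationToRep

variable {Λ : Type u} [CommRing Λ] [IsLocalRing Λ] {p : Λ} {n : ℕ} [IsUniserialOfLength Λ n]

theorem SubPair.filtration_toRep (hp : maximalIdeal Λ = Ideal.span {p}) (X : SubPair Λ) (ℓ : ℕ) :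
    (X.toRep n).filtration ℓ = X.tilde (radPow ℓ ⊤) := by
  obtain hℓ | hℓ := le_or_gt n ℓ
  · rw [PosetRep.filtration_of_le hℓ, radPow_eq_bot hp ((pow_eq_zero_iff_length_le n hp).mpr hℓ)]
    exact SubPair.tilde_bot.symm
  obtain rfl | hℓ₀ := Nat.eq_zero_or_pos ℓ
  · rw [PosetRep.filtration_zero hℓ, radPow_zero]
    exact SubPair.tilde_top.symm
  exact PosetRep.filtration_eq_sub hℓ₀ hℓ

theorem SubPair.exists_repFunctor_map_eq (hp : maximalIdeal Λ = Ideal.span {p}) {X Y : SubPair Λ}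
    (hY : SubPair.bounded p 2 Y) (h : X.toRep n ⟶ Y.toRep n) :
    ∃ f : X ⟶ Y, (repFunctor Λ n).map f = h := by
  have hrad : ∀ ℓ, X.tilde (radPow ℓ ⊤) ≤
      (Y.tilde (radPow ℓ ⊤)).comap (PosetRep.linMap h) := fun ℓ => by
    rw [← X.filtration_toRep (n := n) hp, ← Y.filtration_toRep (n := n) hp]
    exact PosetRep.filtration_le_comap h ℓ
  obtain ⟨f, hf⟩ := SubPair.exists_totalMap_eq hp (isNilpotent_generator n hp) hY hrad
    (PosetRep.Hom.le_comap h .prime) (PosetRep.Hom.le_comap h .dprime)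
  exact ⟨f, PosetRep.hom_ext hf⟩

end FiltrationToRep

/-! ### Bases adapted to a filtration and a subspace -/

section AdaptedBasis

variable {k V : Type*} [DivisionRing k] [AddCommGroup V] [Module k V]

theorem exists_linearIndepOn_superset_le_span {s c : Set V} {G : Submodule k V}
    (hc : LinearIndepOn k id c) (hsc : s ⊆ c) (hcs : c ⊆ s ∪ G)
    (hs : Submodule.span k s ⊓ G ≤ Submodule.span k (s ∩ G)) :
    ∃ b, c ⊆ b ∧ b ⊆ s ∪ G ∧ LinearIndepOn k id b ∧ G ≤ Submodule.span k (b ∩ G) := by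
  obtain ⟨b, hb, hcb, hspan, hbli⟩ := exists_linearIndepOn_id_extension hc hcs
  refine ⟨b, hcb, hb, hbli, fun x hx => ?_⟩
  have hbG : b ⊆ s ∪ b ∩ G := fun y hy => (hb hy).imp_right fun h => ⟨hy, h⟩
  have hxb : x ∈ Submodule.span k s ⊔ Submodule.span k (b ∩ G) := by
    rw [← Submodule.span_union]
    exact Submodule.span_mono hbG (hspan (Or.inr hx))
  obtain ⟨v, hv, w, hw, rfl⟩ := Submodule.mem_sup.mp hxb
  have hwG : w ∈ G := Submodule.span_le.mpr Set.inter_subset_right hw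
  have hvG : v ∈ G := (G.add_mem_iff_left hwG).mp hx
  have hsb : s ∩ G ⊆ b ∩ G := Set.inter_subset_inter_left _ (hsc.trans hcb)
  exact add_mem (Submodule.span_mono hsb (hs ⟨hv, hvG⟩)) hw

theorem exists_linearIndepOn_superset_forall_le_span {F : ℕ → Submodule k V} (hF : Antitone F)
    {N : ℕ} (hN : F N = ⊥) {s : Set V} (hs : LinearIndepOn k id s)
    (hsF : ∀ j, Submodule.span k s ⊓ F j ≤ Submodule.span k (s ∩ F j)) :
    ∃ b, s ⊆ b ∧ b ⊆ s ∪ F 0 ∧ LinearIndepOn k id b ∧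
      ∀ j, F j ≤ Submodule.span k (b ∩ F j) := by
  suffices H : ∃ b, s ⊆ b ∧ b ⊆ s ∪ F 0 ∧ LinearIndepOn k id b ∧
      ∀ j ≥ 0, F j ≤ Submodule.span k (b ∩ F j) by simpa using H
  refine Nat.decreasingInduction (motive := fun m _ => ∃ b, s ⊆ b ∧ b ⊆ s ∪ F m ∧
    LinearIndepOn k id b ∧ ∀ j ≥ m, F j ≤ Submodule.span k (b ∩ F j)) ?_ ?_ N.zero_le
  · rintro m - ⟨c, hsc, hcs, hc, hcF⟩
    obtain ⟨b, hcb, hbs, hb, hbF⟩ := exists_linearIndepOn_superset_le_span hc hsc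
      (hcs.trans (Set.union_subset_union_right s (hF m.le_succ))) (hsF m)
    refine ⟨b, hsc.trans hcb, hbs, hb, fun j hj => ?_⟩
    obtain rfl | hj := eq_or_lt_of_le hj
    · exact hbF
    · exact (hcF j hj).trans (Submodule.span_mono (Set.inter_subset_inter_left _ hcb))
  · exact ⟨s, subset_rfl, Set.subset_union_left, hs, fun j hj => (hN ▸ hF hj).trans bot_le⟩

theorem exists_basis_adapted [FiniteDimensional k V] {F : ℕ → Submodule k V} (hF : Antitone F)
    {N : ℕ} (hzero : F 0 = ⊤) (hN : F N = ⊥) (W : Submodule k V) :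
    ∃ (b : Set V) (_ : Fintype b) (e : Module.Basis b k V),
      (∀ j, F j ≤ Submodule.span k (Set.range e ∩ F j)) ∧
        W ≤ Submodule.span k (Set.range e ∩ W) := by
  obtain ⟨s, -, hsW, hs, hsF⟩ := exists_linearIndepOn_superset_forall_le_span
    (F := fun j => W ⊓ F j) (fun _ _ h => inf_le_inf_left W (hF h)) (N := N)
    (by simp only [hN, inf_bot_eq]) (linearIndepOn_empty k id)
    (fun _ => by simp only [Submodule.span_empty, bot_inf_eq, bot_le])
  simp only [hzero, inf_top_eq, Set.empty_union] at hsW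
  have hWs : W ≤ Submodule.span k s := by
    simpa only [hzero, inf_top_eq, Set.inter_eq_left.mpr hsW] using hsF 0
  obtain ⟨b, hsb, -, hb, hbF⟩ := exists_linearIndepOn_superset_forall_le_span hF hN hs fun j =>
    (inf_le_inf_right _ (Submodule.span_le.mpr hsW)).trans <| (hsF j).trans <|
      Submodule.span_mono (Set.inter_subset_inter_right s inf_le_right)
  have hspan : ⊤ ≤ Submodule.span k b := by
    simpa only [hzero, Submodule.top_coe, Set.inter_univ] using hbF 0
  let e : Module.Basis b k V := .mk hb (by simpa using hspan)
  have he : Set.range e = b := by simp [e]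
  have : Finite b := Module.Finite.finite_basis e
  exact ⟨b, .ofFinite b, e, by rwa [he],
    he.symm ▸ hWs.trans (Submodule.span_mono fun x hx => ⟨hsb hx, hsW hx⟩)⟩

theorem mem_iff_forall_repr_eq_zero {R M ι : Type*} [Semiring R] [AddCommMonoid M] [Module R M]
    (e : Module.Basis ι R M) {W : Submodule R M} (hW : W ≤ Submodule.span R (Set.range e ∩ W))
    {x : M} : x ∈ W ↔ ∀ i, e i ∉ W → e.repr x i = 0 := by
  have hspan : Submodule.span R (e '' {i | e i ∈ W}) = W := by
    refine le_antisymm (Submodule.span_le.mpr (Set.image_subset_iff.mpr fun _ hi => hi)) ?_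
    exact hW.trans (Submodule.span_mono fun _ ⟨⟨i, hi⟩, hiW⟩ => ⟨i, by rwa [← hi] at hiW, hi⟩)
  conv_lhs => rw [← hspan, e.mem_span_image]
  refine forall_congr' fun i => ?_
  rw [Finset.mem_coe, Finsupp.mem_support_iff]
  exact not_imp_comm

end AdaptedBasis

/-! ### Sums of cyclic modules -/

section CyclicSum

variable {Λ : Type u} [CommRing Λ] {ι : Type u} {p : Λ}

/-- The direct sum of the cyclic modules `Λ / (p ^ m i)`, the index set `ι` being finite in all
applications. -/
abbrev CyclicSum (p : Λ) (m : ι → ℕ) : Type u :=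
  (ι → Λ) ⧸ Submodule.pi Set.univ fun i => Ideal.span {p ^ m i}

namespace CyclicSum

theorem mk_eq_zero_iff {m : ι → ℕ} {x : ι → Λ} :
    (Submodule.Quotient.mk x : CyclicSum p m) = 0 ↔ ∀ i, p ^ m i ∣ x i := by
  simp only [Submodule.Quotient.mk_eq_zero, Submodule.mem_pi, Set.mem_univ, true_imp_iff,
    Ideal.mem_span_singleton]

/-- The map from the free module to `⨁ Λ / (p ^ (d i + c i))` that sends the `i`-th basis vector
to `p ^ d i` times the generator of the `i`-th summand: an element of height `d i` that
generates a submodule of length `c i`. -/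
def powMap (p : Λ) (d c : ι → ℕ) : (ι → Λ) →ₗ[Λ] CyclicSum p (d + c) :=
  Submodule.mkQ _ ∘ₗ LinearMap.pi fun i => p ^ d i • LinearMap.proj i

variable {d c : ι → ℕ}

theorem powMap_apply (μ : ι → Λ) :
    powMap p d c μ = Submodule.Quotient.mk fun i => p ^ d i * μ i := rfl

variable [IsLocalRing Λ] {n : ℕ} [IsUniserialOfLength Λ n]

theorem powMap_eq_zero_iff (hp : maximalIdeal Λ = Ideal.span {p}) (hn : ∀ i, d i + c i ≤ n)
    {μ : ι → Λ} : powMap p d c μ = 0 ↔ ∀ i, p ^ c i ∣ μ i := by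
  rw [powMap_apply, mk_eq_zero_iff]
  exact forall_congr' fun i => pow_add_dvd_pow_mul_iff n hp (hn i)

theorem soc_le_range_powMap (hp : maximalIdeal Λ = Ideal.span {p}) (hn : ∀ i, d i + c i ≤ n)
    (hc : ∀ i, 1 ≤ c i) : soc Λ (CyclicSum p (d + c)) ≤ LinearMap.range (powMap p d c) := by
  intro x hx
  obtain ⟨x, rfl⟩ := Submodule.Quotient.mk_surjective _ x
  rw [mem_soc_iff_smul_eq_zero hp, ← Submodule.Quotient.mk_smul, mk_eq_zero_iff] at hx
  have hdvd : ∀ i, p ^ d i ∣ x i := fun i => by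
    have hci := hc i
    have hni := hn i
    obtain ⟨c', hc'⟩ := Nat.exists_eq_add_of_le hci
    have hxi : p ^ (1 + (d i + c')) ∣ p ^ 1 * x i := by
      rw [pow_one]
      convert hx i using 2
      · rw [Pi.add_apply]
        omega
      · rfl
    rw [pow_add_dvd_pow_mul_iff n hp (by omega)] at hxi
    exact (pow_dvd_pow p (by omega)).trans hxi
  choose μ hμ using hdvd
  exact ⟨μ, congrArg Submodule.Quotient.mk (funext fun i => (hμ i).symm)⟩

theorem powMap_mem_soc_iff (hp : maximalIdeal Λ = Ideal.span {p}) (hn : ∀ i, d i + c i ≤ n)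
    (hc : ∀ i, 1 ≤ c i) {μ : ι → Λ} :
    powMap p d c μ ∈ soc Λ (CyclicSum p (d + c)) ↔ ∀ i, p ^ (c i - 1) ∣ μ i := by
  rw [mem_soc_iff_smul_eq_zero hp, ← map_smul, powMap_eq_zero_iff hp hn]
  refine forall_congr' fun i => ?_
  have hle : 1 + (c i - 1) ≤ n := by
    rw [Nat.add_sub_cancel' (hc i)]
    exact (Nat.le_add_left _ _).trans (hn i)
  rw [← pow_add_dvd_pow_mul_iff n hp hle, pow_one, Nat.add_sub_cancel' (hc i),
    Pi.smul_apply, smul_eq_mul]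

theorem powMap_mem_rad_range_iff (hp : maximalIdeal Λ = Ideal.span {p})
    (hn : ∀ i, d i + c i ≤ n) (hc : ∀ i, 1 ≤ c i) {μ : ι → Λ} :
    powMap p d c μ ∈ rad (LinearMap.range (powMap p d c)) ↔ ∀ i, p ∣ μ i := by
  rw [mem_rad_iff hp]
  constructor
  · rintro ⟨_, ⟨ν, rfl⟩, hν⟩ i
    have hzero : powMap p d c (μ - p • ν) = 0 := by rw [map_sub, map_smul, hν, sub_self]
    have hdvd : p ∣ μ i - p * ν i :=
      (dvd_pow_self p (Nat.one_le_iff_ne_zero.mp (hc i))).trans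
        ((powMap_eq_zero_iff hp hn).mp hzero i)
    exact (dvd_sub_left (dvd_mul_right p (ν i))).mp hdvd
  · intro h
    choose ν hν using h
    exact ⟨powMap p d c ν, ⟨ν, rfl⟩, by rw [← map_smul]; exact congrArg _ (funext hν).symm⟩

theorem dvd_of_powMap_mem_radPow (hp : maximalIdeal Λ = Ideal.span {p})
    (hn : ∀ i, d i + c i ≤ n) (hc : ∀ i, 1 ≤ c i) {μ : ι → Λ} {ℓ : ℕ}
    (hμ : powMap p d c μ ∈ radPow ℓ (⊤ : Submodule Λ (CyclicSum p (d + c)))) {i : ι}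
    (hi : d i < ℓ) : p ∣ μ i := by
  obtain ⟨b, -, hb⟩ := (mem_radPow_iff hp).mp hμ
  obtain ⟨ν, rfl⟩ := Submodule.Quotient.mk_surjective _ b
  have hzero : (Submodule.Quotient.mk (fun i => p ^ d i * μ i - p ^ ℓ * ν i) :
      CyclicSum p (d + c)) = 0 := sub_eq_zero.mpr hb.symm
  have hν : p ^ (d i + 1) ∣ p ^ ℓ * ν i := (pow_dvd_pow p hi).mul_right _
  have hsub : p ^ (d i + 1) ∣ p ^ d i * μ i - p ^ ℓ * ν i :=
    (pow_dvd_pow p (Nat.add_le_add_left (hc i) _)).trans (mk_eq_zero_iff.mp hzero i)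
  have h := (dvd_sub_left hν).mp hsub
  rwa [pow_add_dvd_pow_mul_iff n hp ((Nat.add_le_add_left (hc i) _).trans (hn i)), pow_one] at h

theorem powMap_mem_radPow (hp : maximalIdeal Λ = Ideal.span {p}) {μ : ι → Λ} {ℓ : ℕ}
    (hμ : ∀ i, d i < ℓ → μ i = 0) :
    powMap p d c μ ∈ radPow ℓ (⊤ : Submodule Λ (CyclicSum p (d + c))) := by
  refine (mem_radPow_iff hp).mpr
    ⟨Submodule.Quotient.mk fun i => p ^ (d i - ℓ) * μ i, Submodule.mem_top, ?_⟩
  refine congrArg Submodule.Quotient.mk (funext fun i => ?_)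
  change p ^ ℓ * (p ^ (d i - ℓ) * μ i) = p ^ d i * μ i
  obtain hi | hi := lt_or_ge (d i) ℓ
  · simp only [hμ i hi, mul_zero]
  · rw [← mul_assoc, ← pow_add, Nat.add_sub_cancel' hi]

theorem powMap_mem_radPow_sup_iff (hp : maximalIdeal Λ = Ideal.span {p})
    (hn : ∀ i, d i + c i ≤ n) (hc : ∀ i, 1 ≤ c i) {μ : ι → Λ} {ℓ : ℕ} :
    powMap p d c μ ∈ radPow ℓ ⊤ ⊔ rad (LinearMap.range (powMap p d c)) ↔
      ∀ i, d i < ℓ → p ∣ μ i := by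
  classical
  constructor
  · intro h i hi
    obtain ⟨y, hy, z, hz, hyz⟩ := Submodule.mem_sup.mp h
    have hz' : z ∈ LinearMap.range (powMap p d c) := rad_le _ hz
    obtain ⟨κ, rfl⟩ := hz'
    have hμκ : powMap p d c (μ - κ) ∈ radPow ℓ (⊤ : Submodule Λ (CyclicSum p (d + c))) := by
      rwa [map_sub, ← hyz, add_sub_cancel_right]
    exact (dvd_sub_left ((powMap_mem_rad_range_iff hp hn hc).mp hz i)).mp
      (dvd_of_powMap_mem_radPow hp hn hc hμκ hi)
  · intro h
    let κ : ι → Λ := fun i => if d i < ℓ then μ i else 0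
    have hκ : ∀ i, p ∣ κ i := fun i => by
      by_cases hi : d i < ℓ
      · simpa only [κ, if_pos hi] using h i hi
      · simp only [κ, if_neg hi, dvd_zero]
    have hμκ : ∀ i, d i < ℓ → (μ - κ) i = 0 := fun i hi => by
      simp only [κ, Pi.sub_apply, if_pos hi, sub_self]
    rw [← sub_add_cancel μ κ, map_add]
    exact Submodule.add_mem_sup (powMap_mem_radPow hp hμκ)
      ((powMap_mem_rad_range_iff hp hn hc).mpr hκ)

end CyclicSum

end CyclicSum

/-! ### Semilinear presentations of representations -/

section Semilinear

variable {R S L M U V : Type*} [Ring R] [Ring S] {σ : R →+* S}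
  [AddCommGroup L] [Module R L] [AddCommGroup M] [Module R M]
  [AddCommGroup U] [Module S U] [AddCommGroup V] [Module S V]

theorem exists_linearEquiv_apply_eq [RingHomSurjective σ] {g : L →ₛₗ[σ] U} {ψ : L →ₛₗ[σ] V}
    (hg : Function.Surjective g) (hψ : Function.Surjective ψ) (h : ∀ x, g x = 0 ↔ ψ x = 0) :
    ∃ E : U ≃ₗ[S] V, ∀ x, E (g x) = ψ x := by
  have hgψ : ∀ x y, g x = g y ↔ ψ x = ψ y := fun x y => by
    rw [← sub_eq_zero, ← map_sub, h, map_sub, sub_eq_zero]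
  let s := Function.surjInv hg
  have hs : ∀ u, g (s u) = u := Function.surjInv_eq hg
  have hsg : ∀ x, ψ (s (g x)) = ψ x := fun x => (hgψ _ _).mp (hs _)
  let E : U →ₗ[S] V :=
    { toFun := fun u => ψ (s u)
      map_add' := fun u v => by rw [← map_add, ← hgψ, map_add, hs, hs, hs]
      map_smul' := fun r u => by
        obtain ⟨r, rfl⟩ := σ.surjective r
        rw [RingHom.id_apply, ← map_smulₛₗ, ← hgψ, map_smulₛₗ, hs, hs] }
  refine ⟨.ofBijective E ⟨fun u v huv => ?_, fun v => ?_⟩, hsg⟩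
  · rw [← hs u, ← hs v, hgψ]
    exact huv
  · obtain ⟨x, rfl⟩ := hψ v
    exact ⟨g x, hsg x⟩

theorem apply_mem_map_comap_sup_iff {φ : L →ₗ[R] M} {ψ : L →ₛₗ[σ] V} {K : Submodule R M}
    (hK : ∀ x, φ x ∈ K ↔ ψ x = 0) {W : Submodule S V} {x : L} :
    φ x ∈ (W.comap ψ).map φ ⊔ K ↔ ψ x ∈ W := by
  refine ⟨fun h => ?_, fun h => Submodule.mem_sup_left ⟨x, h, rfl⟩⟩
  obtain ⟨_, ⟨y, hy, rfl⟩, z, hz, hyz⟩ := Submodule.mem_sup.mp h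
  have hxy : φ (x - y) ∈ K := by rwa [map_sub, ← hyz, add_sub_cancel_left]
  rw [hK, map_sub, sub_eq_zero] at hxy
  exact hxy ▸ hy

theorem map_comap_sup_map_comap_eq_range (φ : L →ₗ[R] M) {ψ : L →ₛₗ[σ] V}
    (hψ : Function.Surjective ψ) {W W' : Submodule S V} (hW : W ⊔ W' = ⊤) :
    (W.comap ψ).map φ ⊔ (W'.comap ψ).map φ = LinearMap.range φ := by
  refine le_antisymm (sup_le LinearMap.map_le_range LinearMap.map_le_range) ?_
  rintro _ ⟨x, rfl⟩
  obtain ⟨w, hw, w', hw', hx⟩ := Submodule.mem_sup.mp (hW ▸ Submodule.mem_top : ψ x ∈ W ⊔ W')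
  obtain ⟨y, rfl⟩ := hψ w
  have hxy : ψ (x - y) ∈ W' := by rwa [map_sub, ← hx, add_sub_cancel_left]
  rw [← add_sub_cancel y x, map_add]
  exact Submodule.add_mem_sup ⟨y, hw, rfl⟩ ⟨x - y, hxy, rfl⟩

end Semilinear

section ResidueCombination

variable {Λ : Type u} [CommRing Λ] [IsLocalRing Λ] {ι V : Type*} [Fintype ι] [AddCommGroup V]
  [Module (ResidueField Λ) V]

/-- The map `Λ ^ ι → k ^ ι ≃ V` given by a basis of the vector space `V` over the residue field
`k`, as a map that is semilinear along `Λ → k`. -/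
noncomputable def residueCombination (e : Module.Basis ι (ResidueField Λ) V) :
    (ι → Λ) →ₛₗ[residue Λ] V where
  toFun μ := ∑ i, residue Λ (μ i) • e i
  map_add' μ ν := by simp only [Pi.add_apply, map_add, add_smul, Finset.sum_add_distrib]
  map_smul' r μ := by
    simp only [Pi.smul_apply, smul_eq_mul, map_mul, mul_smul, Finset.smul_sum]

variable (e : Module.Basis ι (ResidueField Λ) V)

theorem repr_residueCombination (μ : ι → Λ) (i : ι) :
    e.repr (residueCombination e μ) i = residue Λ (μ i) :=
  congrFun (e.repr_sum_self fun i => residue Λ (μ i)) i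

theorem residueCombination_surjective : Function.Surjective (residueCombination e) := by
  intro v
  choose μ hμ using fun i => residue_surjective (e.repr v i)
  exact ⟨μ, e.ext_elem fun i => by rw [repr_residueCombination, hμ]⟩

variable {e} {p : Λ} {μ : ι → Λ}

theorem residueCombination_mem_iff (hp : maximalIdeal Λ = Ideal.span {p})
    {W : Submodule (ResidueField Λ) V}
    (hW : W ≤ Submodule.span (ResidueField Λ) (Set.range e ∩ W)) :
    residueCombination e μ ∈ W ↔ ∀ i, e i ∉ W → p ∣ μ i := by
  rw [mem_iff_forall_repr_eq_zero e hW]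
  simp only [repr_residueCombination, residue_eq_zero_iff, hp, Ideal.mem_span_singleton]

theorem residueCombination_eq_zero_iff (hp : maximalIdeal Λ = Ideal.span {p}) :
    residueCombination e μ = 0 ↔ ∀ i, p ∣ μ i := by
  rw [← Submodule.mem_bot (ResidueField Λ), residueCombination_mem_iff hp bot_le]
  exact forall_congr' fun i => imp_iff_right (e.ne_zero i)

end ResidueCombination

/-- A linear isomorphism of the total spaces that identifies the subspaces, as an isomorphism of
representations. -/
def PosetRep.isoOfLinearEquiv {k : Type u} [Field k] {P : Type} [PartialOrder P]
    {V W : PosetRep k P} (E : V.V ≃ₗ[k] W.V) (hE : ∀ i v, E v ∈ W.sub i ↔ v ∈ V.sub i) :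
    V ≅ W where
  hom := Hom.mk E fun i v hv => (hE i v).mpr hv
  inv := Hom.mk E.symm fun i w hw => (hE i _).mp <| by
    change E (E.symm w) ∈ W.sub i
    rwa [E.apply_symm_apply]
  hom_inv_id := hom_ext (LinearMap.ext E.symm_apply_apply)
  inv_hom_id := hom_ext (LinearMap.ext E.apply_symm_apply)

section Density

variable {Λ : Type u} [CommRing Λ] [IsLocalRing Λ] {p : Λ} {n : ℕ} [IsUniserialOfLength Λ n]
  {V : PosetRep (ResidueField Λ) (ChainPoset n)}

theorem SubPair.nonempty_toRep_iso {X : SubPair Λ} {L : Type*} [AddCommGroup L] [Module Λ L]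
    {φ : L →ₗ[Λ] X.B} {ψ : L →ₛₗ[residue Λ] V.V} (hψ : Function.Surjective ψ)
    (hV : V.sub .prime ⊔ V.sub .dprime = ⊤)
    (hsoc : soc Λ X.B = ((V.sub .prime).comap ψ).map φ)
    (hA : X.A = ((V.sub .dprime).comap ψ).map φ)
    (hrad : ∀ μ, φ μ ∈ rad (LinearMap.range φ) ↔ ψ μ = 0)
    (hradPow : ∀ ℓ μ,
      φ μ ∈ radPow ℓ ⊤ ⊔ rad (LinearMap.range φ) ↔ ψ μ ∈ V.filtration ℓ) :
    Nonempty (X.toRep n ≅ V) := by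
  have hrange : LinearMap.range φ = X.Aplus := by
    rw [Aplus, sup_comm, hsoc, hA, map_comap_sup_map_comap_eq_range φ hψ hV]
  rw [hrange, rad_Aplus] at hrad hradPow
  have hφ : ∀ μ, φ μ ∈ X.Aplus := fun μ => hrange ▸ ⟨μ, rfl⟩
  let g : L →ₛₗ[residue Λ] X.TotalSpace :=
    { X.proj ∘ₗ φ.codRestrict X.Aplus hφ with
      map_smul' := fun r μ =>
        (map_smul (X.proj ∘ₗ φ.codRestrict X.Aplus hφ) r μ).trans
          (residue_smul_totalSpace ..).symm }
  have hg : Function.Surjective g := fun v => by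
    obtain ⟨⟨x, hx⟩, rfl⟩ := X.proj_surjective v
    obtain ⟨μ, rfl⟩ := hrange.ge hx
    exact ⟨μ, rfl⟩
  have : RingHomSurjective (residue Λ) := ⟨residue_surjective⟩
  obtain ⟨E, hE⟩ := exists_linearEquiv_apply_eq hg hψ fun μ =>
    (X.proj_eq_zero_iff _).trans (hrad μ)
  refine ⟨PosetRep.isoOfLinearEquiv E fun i v => ?_⟩
  obtain ⟨μ, rfl⟩ := hg v
  refine (iff_of_eq (congrArg (· ∈ V.sub i) (hE μ))).trans (Iff.trans ?_ proj_mem_tilde_iff.symm)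
  cases i with
  | chain ℓ h₁ h₂ => exact PosetRep.filtration_eq_sub (V := V) h₁ h₂ ▸ (hradPow ℓ μ).symm
  | prime => exact (hsoc ▸ apply_mem_map_comap_sup_iff hrad).symm
  | dprime => exact (hA ▸ apply_mem_map_comap_sup_iff hrad).symm

namespace PosetRep

theorem exists_bounded_toRep_iso_of_basis (hp : maximalIdeal Λ = Ideal.span {p})
    (hV : V.sub .prime ⊔ V.sub .dprime = ⊤) {ι : Type u} [Finite ι]
    {e : Module.Basis ι (ResidueField Λ) V.V}
    (heF : ∀ ℓ, V.filtration ℓ ≤ Submodule.span _ (Set.range e ∩ V.filtration ℓ))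
    (heV : V.sub .prime ≤ Submodule.span _ (Set.range e ∩ V.sub .prime)) {d c : ι → ℕ}
    (hd : ∀ i ℓ, e i ∈ V.filtration ℓ ↔ ℓ ≤ d i) (hc : ∀ i, e i ∈ V.sub .prime ↔ c i = 1)
    (hc₁ : ∀ i, 1 ≤ c i) (hc₂ : ∀ i, c i ≤ 2) (hn : ∀ i, d i + c i ≤ n) :
    ∃ X : SubPair Λ, SubPair.bounded p 2 X ∧ Nonempty (X.toRep n ≅ V) := by
  have := Fintype.ofFinite ι
  let φ := CyclicSum.powMap p d c
  let ψ := residueCombination e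
  have hsoc_iff : ∀ μ, φ μ ∈ soc Λ _ ↔ ψ μ ∈ V.sub .prime := fun μ => by
    rw [CyclicSum.powMap_mem_soc_iff hp hn hc₁, residueCombination_mem_iff hp heV]
    refine forall_congr' fun i => ?_
    rw [hc]
    obtain h | h : c i = 1 ∨ c i = 2 := by have := hc₁ i; have := hc₂ i; omega
    all_goals simp [h]
  have hsoc : soc Λ (CyclicSum p (d + c)) = ((V.sub .prime).comap ψ).map φ := by
    refine le_antisymm (fun x hx => ?_)
      (Submodule.map_le_iff_le_comap.mpr fun μ => (hsoc_iff μ).mpr)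
    obtain ⟨μ, rfl⟩ := CyclicSum.soc_le_range_powMap hp hn hc₁ hx
    exact ⟨μ, (hsoc_iff μ).mp hx, rfl⟩
  let X : SubPair Λ := { B := CyclicSum p (d + c), A := ((V.sub .dprime).comap ψ).map φ }
  refine ⟨X, ?_, SubPair.nonempty_toRep_iso (X := X) (residueCombination_surjective e) hV hsoc rfl
    (fun μ => ?_) fun ℓ μ => ?_⟩
  · rintro _ ⟨μ, -, rfl⟩
    rw [← map_smul, CyclicSum.powMap_eq_zero_iff hp hn]
    exact fun i => (pow_dvd_pow p (hc₂ i)).mul_right _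
  · exact (CyclicSum.powMap_mem_rad_range_iff hp hn hc₁).trans
      (residueCombination_eq_zero_iff hp).symm
  · refine (CyclicSum.powMap_mem_radPow_sup_iff hp hn hc₁).trans ?_
    simp only [residueCombination_mem_iff hp (heF ℓ), hd, not_le]

theorem exists_bounded_toRep_iso (hp : maximalIdeal Λ = Ideal.span {p})
    (hV : isAdmissible (ResidueField Λ) n V) :
    ∃ X : SubPair Λ, SubPair.bounded p 2 X ∧ Nonempty (X.toRep n ≅ V) := by
  classical
  have hn := length_pos n hp
  obtain ⟨b, _, e, heF, heV⟩ := exists_basis_adapted V.filtration_antitone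
    (filtration_zero hn) (filtration_of_le le_rfl) (V.sub .prime)
  choose d hdn hd using fun i => exists_lt_forall_mem_iff_le V.filtration_antitone
    (filtration_zero hn) (filtration_of_le le_rfl) (e.ne_zero i)
  have hlevel : V.filtration (n - 1) ≤ V.sub .prime := by
    rw [filtration, if_pos (by omega)]
    exact hV.1
  have hdn₂ : ∀ i, e i ∉ V.sub .prime → d i + 2 ≤ n := fun i hi => by
    by_contra! h
    exact hi (hlevel ((hd i _).mpr (by omega)))
  refine exists_bounded_toRep_iso_of_basis hp hV.2 heF heV hd
    (c := fun i => if e i ∈ V.sub .prime then 1 else 2) (fun i => by simp) (fun i => ?_)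
    (fun i => ?_) fun i => ?_
  all_goals split_ifs with hi
  · exact le_rfl
  · exact one_le_two
  · exact one_le_two
  · exact le_rfl
  · exact hdn i
  · exact hdn₂ i hi

end PosetRep

end Density

/-! ### The equivalence -/

section Equivalence

variable {Λ : Type u} [CommRing Λ] [IsLocalRing Λ] (n : ℕ) [IsUniserialOfLength Λ n] {p : Λ}

theorem functorF_map_eq_zero_iff {X Y : BoundedPair p 2} (f : X ⟶ Y) :
    (functorF n p).map f = 0 ↔ f ∈ idealN p X Y := by
  constructor
  · rintro h _ ⟨x, hx, rfl⟩
    have hfx := LinearMap.congr_fun (congrArg PosetRep.linMap h) (X.obj.proj ⟨x, hx⟩)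
    exact (Y.obj.proj_eq_zero_iff _).mp hfx
  · intro h
    refine PosetRep.hom_ext (LinearMap.ext fun v => ?_)
    obtain ⟨x, rfl⟩ := X.obj.proj_surjective v
    exact (Y.obj.proj_eq_zero_iff _).mpr (h ⟨x, x.2, rfl⟩)

theorem SubPair.isAdmissible_toRep (hp : maximalIdeal Λ = Ideal.span {p}) (X : SubPair Λ) :
    PosetRep.isAdmissible (ResidueField Λ) n (X.toRep n) := by
  have hn := length_pos n hp
  have hrad : radPow (n - 1) (⊤ : Submodule Λ X.B) ≤ soc Λ X.B := by
    intro x hx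
    obtain ⟨b, -, rfl⟩ := (mem_radPow_iff hp).mp hx
    rw [mem_soc_iff_smul_eq_zero hp, smul_smul, ← pow_succ', Nat.sub_add_cancel hn,
      (pow_eq_zero_iff_length_le n hp).mpr le_rfl, zero_smul]
  constructor
  · have hlevel : (X.toRep n).level (n - 1) = X.tilde (radPow (n - 1) ⊤) :=
      (if_pos (Nat.sub_lt hn one_pos)).symm.trans (filtration_toRep hp X _)
    exact hlevel.trans_le (X.tilde_mono hrad)
  · refine eq_top_iff.mpr fun v _ => ?_
    obtain ⟨⟨x, hx⟩, rfl⟩ := X.proj_surjective v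
    obtain ⟨a, ha, s, hs, rfl⟩ := Submodule.mem_sup.mp hx
    have hadd : X.proj ⟨a + s, hx⟩ =
        X.proj ⟨a, Submodule.mem_sup_left ha⟩ + X.proj ⟨s, Submodule.mem_sup_right hs⟩ := rfl
    rw [sup_comm, hadd]
    exact Submodule.add_mem_sup (proj_mem_tilde ha) (proj_mem_tilde hs)

/-- The functor `F` with values in `rep'_k P_n`. -/
noncomputable def functorFAdmissible (hp : maximalIdeal Λ = Ideal.span {p}) :
    BoundedPair p 2 ⥤ (PosetRep.isAdmissible (ResidueField Λ) n).FullSubcategory :=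
  (PosetRep.isAdmissible (ResidueField Λ) n).lift (functorF n p)
    fun X => X.obj.isAdmissible_toRep n hp

theorem functorFAdmissible_map_eq_iff (hp : maximalIdeal Λ = Ideal.span {p})
    {X Y : BoundedPair p 2} (f g : X ⟶ Y) :
    (functorFAdmissible n hp).map f = (functorFAdmissible n hp).map g ↔ relN p f g := by
  rw [relN, ← functorF_map_eq_zero_iff n, Functor.map_sub, sub_eq_zero]
  exact ⟨fun h => congrArg (fun φ => φ.hom) h, fun h => ObjectProperty.hom_ext _ h⟩

/-- The functor `S_2(Λ) / N ⥤ rep'_k P_n` induced by `F`. -/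
noncomputable def functorFbar (hp : maximalIdeal Λ = Ideal.span {p}) :
    QuotientN p ⥤ (PosetRep.isAdmissible (ResidueField Λ) n).FullSubcategory :=
  CategoryTheory.Quotient.lift (relN p) (functorFAdmissible n hp)
    fun _ _ f g h => (functorFAdmissible_map_eq_iff n hp f g).mpr h

theorem functorFbar_additive (hp : maximalIdeal Λ = Ideal.span {p}) :
    (functorFbar n hp).Additive where
  map_add {X Y f g} := by
    obtain ⟨f, rfl⟩ := (Quotient.functor (relN p)).map_surjective f
    obtain ⟨g, rfl⟩ := (Quotient.functor (relN p)).map_surjective g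
    exact ObjectProperty.hom_ext _ ((functorF n p).map_add (f := f) (g := g))

theorem functorFbar_isEquivalence (hp : maximalIdeal Λ = Ideal.span {p}) :
    (functorFbar n hp).IsEquivalence where
  faithful.map_injective {X Y} f g h := by
    obtain ⟨f, rfl⟩ := (Quotient.functor (relN p)).map_surjective f
    obtain ⟨g, rfl⟩ := (Quotient.functor (relN p)).map_surjective g
    exact CategoryTheory.Quotient.sound _ ((functorFAdmissible_map_eq_iff n hp f g).mp h)
  full.map_surjective {X Y} h := by
    obtain ⟨f, hf⟩ := SubPair.exists_repFunctor_map_eq hp Y.as.property h.hom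
    exact ⟨(Quotient.functor (relN p)).map (ObjectProperty.homMk f), ObjectProperty.hom_ext _ hf⟩
  essSurj.mem_essImage V := by
    obtain ⟨X, hX, ⟨i⟩⟩ := PosetRep.exists_bounded_toRep_iso hp V.property
    exact ⟨(Quotient.functor (relN p)).obj ⟨X, hX⟩,
      ⟨(PosetRep.isAdmissible (ResidueField Λ) n).isoMk i⟩⟩

end Equivalence

theorem mainTheorem1 (Λ : Type u) [CommRing Λ] [IsLocalRing Λ] (n : ℕ) [IsUniserialOfLength Λ n]
    (p : Λ) (hp : maximalIdeal Λ = Ideal.span {p}) :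
    (∀ (X Y : BoundedPair p 2) (f : X ⟶ Y), (functorF n p).map f = 0 ↔ f ∈ idealN p X Y) ∧
    ∃ Fbar : QuotientN p ⥤ (PosetRep.isAdmissible (ResidueField Λ) n).FullSubcategory,
      Quotient.functor (relN p) ⋙ Fbar ⋙ (PosetRep.isAdmissible (ResidueField Λ) n).ι = functorF n p ∧
      Fbar.Additive ∧ Fbar.IsEquivalence :=
  ⟨fun _ _ f => functorF_map_eq_zero_iff n f, functorFbar n hp, rfl, functorFbar_additive n hp,
    functorFbar_isEquivalence n hp⟩
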